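/- Let $\Sigma_2=\{0,1\}^{\mathbb Z}$ with the product topology and let $\sigma:\Sigma_2\to\Sigma_2$, $(\sigma s)_i=s_{i+1}$, be the shift homeomorphism. A nonempty compact set $Y\subset\Sigma_2$ with $\sigma(Y)=Y$ is called strictly ergodic if $(Y,\sigma|_Y)$ is minimal (the orbit $\{\sigma^n(y):n\in\mathbb Z\}$ of every $y\in Y$ is dense in $Y$) and uniquely ergodic (there is exactly one $\sigma|_Y$-invariant Borel probability measure on $Y$). Let $\mathcal S(\Sigma_2,\sigma)$ be the set of all strictly ergodic subsets of $\Sigma_2$, with the topology induced by the map that sends $Y$ to its unique invariant probability measure, viewed as a measure on $\Sigma_2$, where probability measures on $\Sigma_2$ carry the weak topology. A Denjoy example is an orientation-preserving homeomorphism $g$ of the circle $\mathbb R/\mathbb Z$ with irrational rotation number such that $(\mathbb R/\mathbb Z,g)$ is not minimal; it has a unique minimal set. A compact set $Y\subset\Sigma_2$ with $\sigma(Y)=Y$ is called a Denjoy minimal set if $(Y,\sigma|_Y)$ is topologically conjugate to the restriction of some Denjoy example to its minimal set. Denjoy minimal sets are strictly ergodic; let $\mathcal D(\Sigma_2,\sigma)\subset\mathcal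 S(\Sigma_2,\sigma)$ be the subspace of all Denjoy minimal subsets of $\Sigma_2$. **Theorem 0.1.** The space $\mathcal S(\Sigma_2,\sigma)$ contains a subspace homeomorphic to the Hilbert cube $[0,1]^{\mathbb N}$, and for every natural number $n$ the space $\mathcal D(\Sigma_2,\sigma)$ contains a subspace homeomorphic to the closed unit ball of $\mathbb R^n$. -/

import Mathlib

open MeasureTheory Set

noncomputable section

namespace WeakDisks

/-- A homeomorphism `h` of `X` is minimal if `X` is nonempty and the full (two-sided) orbit of
every point is dense. Here `h ^ n` is the `n`-fold composition. -/
def IsMinimalSystem {X : Type*} [TopologicalSpace X] (h : X ≃ₜ X) : Prop :=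
  Nonempty X ∧ ∀ x : X, Dense (Set.range fun n : ℤ => (h ^ n) x)

/-- `h` has exactly one invariant Borel probability measure. -/
def IsUniquelyErgodicSystem {X : Type*} [TopologicalSpace X] [MeasurableSpace X] [BorelSpace X]
    (h : X ≃ₜ X) : Prop :=
  ∃! μ : ProbabilityMeasure X, MeasurePreserving h (μ : Measure X) (μ : Measure X)

/-- Strictly ergodic: minimal and uniquely ergodic. -/
def IsStrictlyErgodicSystem {X : Type*} [TopologicalSpace X] [MeasurableSpace X] [BorelSpace X]
    (h : X ≃ₜ X) : Prop :=
  IsMinimalSystem h ∧ IsUniquelyErgodicSystem h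

/-- Topological conjugacy of `(X, h)` and `(Y, g)`. -/
def AreConjugate {X Y : Type*} [TopologicalSpace X] [TopologicalSpace Y]
    (h : X ≃ₜ X) (g : Y ≃ₜ Y) : Prop :=
  ∃ c : X ≃ₜ Y, ∀ x : X, c (h x) = g (c x)

/-- The restriction of a homeomorphism to an invariant set. -/
def restrict {Z : Type*} [TopologicalSpace Z] (h : Z ≃ₜ Z) (Y : Set Z) (hY : h '' Y = Y) :
    Y ≃ₜ Y :=
  (h.image Y).trans (Homeomorph.setCongr hY)

/-- `Y` is a minimal set of `(Z, h)`. -/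
def IsMinimalSet {Z : Type*} [TopologicalSpace Z] (h : Z ≃ₜ Z) (Y : Set Z) : Prop :=
  IsCompact Y ∧ ∃ hY : h '' Y = Y, IsMinimalSystem (restrict h Y hY)

/-- `Y` is a compact invariant subset of `(Z, h)` that is strictly ergodic. -/
def IsStrictlyErgodicSet {Z : Type*} [TopologicalSpace Z] [MeasurableSpace Z] [BorelSpace Z]
    (h : Z ≃ₜ Z) (Y : Set Z) : Prop :=
  IsCompact Y ∧ ∃ hY : h '' Y = Y, IsStrictlyErgodicSystem (restrict h Y hY)

/-- The homeomorphism `g` of the circle `ℝ / ℤ` preserves orientation and has rotation number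
`τ` modulo `1`: `τ` is the translation number of a continuous monotone degree-one lift of `g`. -/
def HasRotationNumber (g : AddCircle (1 : ℝ) ≃ₜ AddCircle (1 : ℝ)) (τ : ℝ) : Prop :=
  ∃ F : CircleDeg1Lift, Continuous F ∧
    (∀ x : ℝ, ((F x : ℝ) : AddCircle (1 : ℝ)) = g (x : AddCircle (1 : ℝ))) ∧
    F.translationNumber = τ

/-- A Denjoy example: a circle homeomorphism with irrational rotation number which is not
minimal. -/
def IsDenjoyExample (g : AddCircle (1 : ℝ) ≃ₜ AddCircle (1 : ℝ)) : Prop :=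
  (∃ τ : ℝ, Irrational τ ∧ HasRotationNumber g τ) ∧ ¬ IsMinimalSystem g

/-- `(X, h)` is an abstract Denjoy minimal set: it is topologically conjugate to the (unique)
minimal set of a Denjoy example. -/
def IsDenjoyMinimalSystem {X : Type*} [TopologicalSpace X] (h : X ≃ₜ X) : Prop :=
  ∃ g : AddCircle (1 : ℝ) ≃ₜ AddCircle (1 : ℝ), IsDenjoyExample g ∧
    ∃ (M : Set (AddCircle (1 : ℝ))) (hM : g '' M = M),
      IsMinimalSet g M ∧ AreConjugate h (restrict g M hM)

/-- `Y` is a compact invariant subset of `(Z, h)` that is a Denjoy minimal set. -/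
def IsDenjoyMinimalSet {Z : Type*} [TopologicalSpace Z] (h : Z ≃ₜ Z) (Y : Set Z) : Prop :=
  IsCompact Y ∧ ∃ hY : h '' Y = Y, IsDenjoyMinimalSystem (restrict h Y hY)

section Spaces

variable {Z : Type*} [TopologicalSpace Z] [MeasurableSpace Z] [BorelSpace Z]

/-- The space `S(Z, h)` of strictly ergodic invariant subsets. -/
def StrictlyErgodicSpace (h : Z ≃ₜ Z) : Type _ :=
  {Y : Set Z // IsStrictlyErgodicSet h Y}

/-- The natural map from `S(Z, h)` to Borel probability measures on `Z`: the unique invariant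
probability measure of `(Y, h)`, regarded as a measure on `Z`. -/
def StrictlyErgodicSpace.measure {h : Z ≃ₜ Z} (Y : StrictlyErgodicSpace h) :
    ProbabilityMeasure Z :=
  (Y.2.2.choose_spec.2.exists.choose).map
    (f := (Subtype.val : Y.1 → Z)) measurable_subtype_coe.aemeasurable

/-- The weak topology on `S(Z, h)`: the one induced, through the unique invariant measures, by
weak convergence of probability measures on `Z`. -/
instance (h : Z ≃ₜ Z) : TopologicalSpace (StrictlyErgodicSpace h) :=
  TopologicalSpace.induced StrictlyErgodicSpace.measure inferInstance

/-- The set `D(Z, h)` of Denjoy minimal subsets. Every Denjoy minimal set is strictly ergodic,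
so these are regarded as points of `S(Z, h)`, from which `D(Z, h)` takes its topology. -/
def denjoySpace (h : Z ≃ₜ Z) : Set (StrictlyErgodicSpace h) :=
  {Y | IsDenjoyMinimalSet h Y.1}

end Spaces

/-- The full two-shift on `{0,1}^ℤ`: `(σ s) i = s (i + 1)`. -/
def shift : (ℤ → Fin 2) ≃ₜ (ℤ → Fin 2) where
  toFun s i := s (i + 1)
  invFun s i := s (i - 1)
  left_inv s := by funext i; simp
  right_inv s := by funext i; simp
  continuous_toFun := by fun_prop
  continuous_invFun := by fun_prop

end WeakDisks

end

/-! Both embeddings come from coding one irrational rotation, by `√2`, with respect to varying sets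
`X` of the circle. The subshift `codingSet α X` is the closure of the itineraries of points whose
orbit avoids the frontier of `X`. Each of its points is compatible with some circle point
(`exists_codes`), and density of rotation orbits gives minimality. If no nonzero translation matches
`X` with itself up to boundary, the compatible circle point is unique, so the subshift maps
continuously onto the rotation. When moreover the frontier is null, almost every fibre is a single
itinerary, so unique ergodicity passes from the rotation to the subshift, whose measure is the law
of the itinerary of a uniform point (`map_val_eq_of_invariant`).

For a family `X t`, the law varies weakly continuously once almost every point keeps its membership
under small changes of `t`. It determines `t` when distinct members never match under translation:
equal laws force the subshifts to meet, and a common point produces a match (`Codes.matches`).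
Compactness of the parameter space then gives an embedding (`isEmbedding_codingPoint`). The sets
used consist of one block in each dyadic window `[2⁻ᵏ/8, 2⁻ᵏ/4)`, with the fraction `τ k` of the
window as free parameter. Infinitely many free fractions give the Hilbert cube.

For balls only the first `n` fractions vary and the others equal `1`, so the indicator of `X` has
one-sided limits everywhere. Opening a gap over every point whose orbit meets the frontier turns the
rotation into a Denjoy homeomorphism. On the Cantor set left by the gaps the indicator becomes
continuous, and the itinerary map is a conjugacy onto the coding subshift
(`isDenjoyMinimalSet_codingSet`). -/

namespace RotationCoding

open WeakDisks Filter Topology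

variable {α : UnitAddCircle} {X X' : Set UnitAddCircle}

instance : IsProbabilityMeasure (volume : Measure UnitAddCircle) := ⟨by simp⟩

/-! ### Itineraries of a rotation and minimality of the coding subshift -/

open Classical in
/-- The itinerary of `x` under rotation by `α` with respect to the set `X`. -/
noncomputable def itinerary (α : UnitAddCircle) (X : Set UnitAddCircle) (x : UnitAddCircle) : ℤ → Fin 2 :=
  fun i => if x + i • α ∈ X then 1 else 0

/-- `s` is compatible with being a limit of itineraries of points tending to `x`. -/
def Codes (α : UnitAddCircle) (X : Set UnitAddCircle) (x : UnitAddCircle) (s : ℤ → Fin 2) : Prop :=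
  ∀ i : ℤ, (s i = 1 → x + i • α ∈ closure X) ∧ (s i = 0 → x + i • α ∈ closure Xᶜ)

/-- The points whose orbit under rotation avoids the frontier of `X`. -/
def generic (α : UnitAddCircle) (X : Set UnitAddCircle) : Set UnitAddCircle :=
  {x | ∀ i : ℤ, x + i • α ∉ frontier X}

/-- The subshift generated by the itineraries of generic points. -/
def codingSet (α : UnitAddCircle) (X : Set UnitAddCircle) : Set (ℤ → Fin 2) :=
  closure (itinerary α X '' generic α X)

theorem codes_itinerary (x : UnitAddCircle) : Codes α X x (itinerary α X x) := by
  intro i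
  by_cases h : x + i • α ∈ X
  · simpa [itinerary, h] using subset_closure h
  · simpa [itinerary, h] using subset_closure (s := Xᶜ) h

theorem isClosed_codes :
    IsClosed {p : UnitAddCircle × (ℤ → Fin 2) | Codes α X p.1 p.2} := by
  have key : ∀ (i : ℤ) (b : Fin 2) (C : Set UnitAddCircle), IsClosed C →
      IsClosed {p : UnitAddCircle × (ℤ → Fin 2) | p.2 i = b → p.1 + i • α ∈ C} := by
    intro i b C hC
    have : {p : UnitAddCircle × (ℤ → Fin 2) | p.2 i = b → p.1 + i • α ∈ C} =
        (fun p : UnitAddCircle × (ℤ → Fin 2) => p.2 i) ⁻¹' {b}ᶜ ∪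
          (fun p : UnitAddCircle × (ℤ → Fin 2) => p.1 + i • α) ⁻¹' C := by
      ext p; simp [imp_iff_not_or]
    rw [this]
    exact ((isClosed_discrete _).preimage (by fun_prop)).union (hC.preimage (by fun_prop))
  simp only [Codes, ofPred_forall, ofPred_and]
  exact isClosed_iInter fun i =>
    (key i 1 _ isClosed_closure).inter (key i 0 _ isClosed_closure)

theorem shift_apply (s : ℤ → Fin 2) (i : ℤ) : shift s i = s (i + 1) := rfl

theorem shift_zpow_apply (s : ℤ → Fin 2) (n i : ℤ) : (shift ^ n) s i = s (i + n) := by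
  induction n generalizing i with
  | zero => simp
  | succ n ih =>
    rw [add_comm (n : ℤ) 1, zpow_one_add, Homeomorph.mul_apply, shift_apply, ih]
    congr 1; ring
  | pred n ih =>
    have h : (shift ^ (-(n : ℤ) - 1)) = shift⁻¹ * shift ^ (-(n : ℤ)) := by
      rw [← zpow_neg_one, ← zpow_add]; congr 1; ring
    rw [h, Homeomorph.mul_apply]
    change (shift ^ (-(n : ℤ))) s (i - 1) = _
    rw [ih]; congr 1; ring

theorem itinerary_add (x : UnitAddCircle) :
    itinerary α X (x + α) = shift (itinerary α X x) := by
  funext i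
  have : x + α + i • α = x + (i + 1) • α := by rw [add_zsmul, one_zsmul]; abel
  simp only [itinerary, shift_apply]
  rw [this]

theorem generic_add_zsmul {x : UnitAddCircle} (hx : x ∈ generic α X) (n : ℤ) :
    x + n • α ∈ generic α X := fun i => by
  have : x + n • α + i • α = x + (n + i) • α := by rw [add_zsmul]; abel
  rw [this]; exact hx _

theorem shift_image_codingSet : shift '' codingSet α X = codingSet α X := by
  rw [codingSet, shift.image_closure]
  congr 1
  ext s
  simp only [mem_image, exists_exists_and_eq_and]
  constructor
  · rintro ⟨x, hx, rfl⟩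
    exact ⟨x + α, by simpa using generic_add_zsmul hx 1, itinerary_add x⟩
  · rintro ⟨x, hx, rfl⟩
    refine ⟨x + (-1 : ℤ) • α, generic_add_zsmul hx _, ?_⟩
    rw [← itinerary_add]; simp

/-- Compatibility is a closed relation and the circle is compact, so the sequences compatible with
some point form a closed set, and it contains every itinerary. -/
theorem exists_codes {s : ℤ → Fin 2} (hs : s ∈ codingSet α X) : ∃ x, Codes α X x s := by
  have hcl : IsClosed (Prod.snd '' {p : UnitAddCircle × (ℤ → Fin 2) | Codes α X p.1 p.2}) :=
    isClosedMap_snd_of_compactSpace _ isClosed_codes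
  have := closure_minimal (s := itinerary α X '' generic α X) (by
    rintro _ ⟨x, -, rfl⟩
    exact ⟨(x, _), codes_itinerary x, rfl⟩) hcl hs
  obtain ⟨⟨x, _⟩, hx, rfl⟩ := this
  exact ⟨x, hx⟩

theorem dense_orbit (hα : DenseRange fun n : ℤ => n • α) (x : UnitAddCircle) :
    DenseRange fun n : ℤ => x + n • α := by
  have h : DenseRange (fun y : UnitAddCircle => x + y) :=
    (add_left_surjective x).denseRange
  have hc : Continuous (fun y : UnitAddCircle => x + y) := by fun_prop
  exact DenseRange.comp h hα hc

/-- Compatibility leaves a symbol undetermined only when the orbit meets the frontier. -/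
theorem Codes.eq_itinerary {x : UnitAddCircle} {s : ℤ → Fin 2} (h : Codes α X x s)
    (hx : x ∈ generic α X) : s = itinerary α X x := by
  funext i
  have hi : x + i • α ∉ closure X ∩ closure Xᶜ := by
    have := hx i
    rwa [frontier_eq_closure_inter_closure] at this
  have hs : s i = 0 ∨ s i = 1 := by omega
  by_cases hX : x + i • α ∈ X
  · rcases hs with hs | hs
    · exact absurd ⟨subset_closure hX, (h i).2 hs⟩ hi
    · simp [itinerary, hX, hs]
  · rcases hs with hs | hs
    · simp [itinerary, hX, hs]
    · exact absurd ⟨(h i).1 hs, subset_closure (s := Xᶜ) hX⟩ hi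

theorem Codes.itinerary_mem_closure_orbit (hα : DenseRange fun n : ℤ => n • α)
    {x x' : UnitAddCircle} {s : ℤ → Fin 2} (h : Codes α X x s) (hx' : x' ∈ generic α X) :
    itinerary α X x' ∈ closure (range fun n : ℤ => (shift ^ n) s) := by
  -- This filter describes times `n` along which `x + n • α` tends to `x'`. Along it each symbol of
  -- the shifted sequence is eventually constant, since `x' + i • α` is off the frontier.
  have hne : (comap (fun n : ℤ => x + n • α) (𝓝 x')).NeBot := by
    rw [comap_neBot_iff]
    intro t ht
    obtain ⟨n, hn⟩ := (dense_orbit hα x).exists_mem_open isOpen_interior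
      ⟨x', mem_interior_iff_mem_nhds.2 ht⟩
    exact ⟨n, interior_subset hn⟩
  refine mem_closure_of_tendsto (f := fun n : ℤ => (shift ^ n) s)
    (b := comap (fun n : ℤ => x + n • α) (𝓝 x')) ?_ (Eventually.of_forall fun n => ⟨n, rfl⟩)
  rw [tendsto_pi_nhds]
  intro i
  have ht : Tendsto (fun n : ℤ => x + (i + n) • α) (comap (fun n : ℤ => x + n • α) (𝓝 x'))
      (𝓝 (x' + i • α)) := by
    have : (fun n : ℤ => x + (i + n) • α) = fun n : ℤ => (x + n • α) + i • α := by
      funext n; rw [add_zsmul]; abel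
    rw [this]
    exact tendsto_comap.add_const _
  have hs : ∀ j, s j = 0 ∨ s j = 1 := fun j => by omega
  refine tendsto_nhds_of_eventually_eq ?_
  have hi := hx' i
  by_cases hX : x' + i • α ∈ X
  · have hint : x' + i • α ∈ interior X := by
      by_contra hc; exact hi ⟨subset_closure hX, hc⟩
    filter_upwards [ht (isOpen_interior.mem_nhds hint)] with n hn
    rw [shift_zpow_apply]
    rcases hs (i + n) with h0 | h1
    · have := (h _).2 h0
      rw [closure_compl] at this
      exact absurd hn this
    · simp [itinerary, hX, h1]
  · have hint : x' + i • α ∉ closure X := by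
      intro hc; exact hi ⟨hc, fun h => hX (interior_subset h)⟩
    filter_upwards [ht (isClosed_closure.isOpen_compl.mem_nhds hint)] with n hn
    rw [shift_zpow_apply]
    rcases hs (i + n) with h0 | h1
    · simp [itinerary, hX, h0]
    · exact absurd ((h _).1 h1) hn

theorem coe_restrict_zpow {Z : Type*} [TopologicalSpace Z] (h : Z ≃ₜ Z) (Y : Set Z)
    (hY : h '' Y = Y) (n : ℤ) (y : Y) : ((restrict h Y hY ^ n) y : Z) = (h ^ n) y := by
  have h1 : ∀ y : Y, ((restrict h Y hY) y : Z) = h y := fun y => rfl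
  have h2 : ∀ y : Y, ((restrict h Y hY)⁻¹ y : Z) = h⁻¹ y := fun y => by
    apply h.injective
    rw [← h1]
    change ((restrict h Y hY * (restrict h Y hY)⁻¹) y : Z) = (h * h⁻¹) (y : Z)
    simp
  induction n generalizing y with
  | zero => simp
  | succ n ih => rw [zpow_add_one, zpow_add_one, Homeomorph.mul_apply, ih, h1]; rfl
  | pred n ih => rw [zpow_sub_one, zpow_sub_one, Homeomorph.mul_apply, ih, h2]; rfl

theorem isMinimal_codingSet (hα : DenseRange fun n : ℤ => n • α) (hne : (generic α X).Nonempty) :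
    IsMinimalSystem (restrict shift (codingSet α X) shift_image_codingSet) := by
  refine ⟨(hne.image _).closure.to_subtype, fun y => ?_⟩
  obtain ⟨x, hx⟩ := exists_codes y.2
  rw [Subtype.dense_iff, ← range_comp]
  have : (Subtype.val ∘ fun n : ℤ => (restrict shift (codingSet α X) shift_image_codingSet ^ n) y)
      = fun n : ℤ => (shift ^ n) (y : ℤ → Fin 2) := by
    funext n; exact coe_restrict_zpow ..
  rw [this]
  refine closure_minimal ?_ isClosed_closure
  rintro _ ⟨x', hx', rfl⟩
  exact hx.itinerary_mem_closure_orbit hα hx'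

/-! ### Sequences shared by two codings -/

/-- If the translate by `c` carries `X` onto `X'` up to boundaries. -/
def Matches (X X' : Set UnitAddCircle) (c : UnitAddCircle) : Prop :=
  (∀ u ∈ interior X, u + c ∈ closure X') ∧ ∀ u ∈ interior Xᶜ, u + c ∈ closure X'ᶜ

/-- Reading the same symbol at time `n` relates `x + n • α` to `x' + n • α`, its translate by `x' -
x`. Density of the orbit of `x` extends this relation to all points of the open sets concerned. -/
theorem Codes.matches (hα : DenseRange fun n : ℤ => n • α) {x x' : UnitAddCircle}
    {s : ℤ → Fin 2} (h : Codes α X x s) (h' : Codes α X' x' s) : Matches X X' (x' - x) := by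
  have key : ∀ (U C : Set UnitAddCircle), IsOpen U → IsClosed C →
      (∀ n : ℤ, x + n • α ∈ U → x' + n • α ∈ C) → ∀ u ∈ U, u + (x' - x) ∈ C := by
    intro U C hU hC hUC u hu
    by_contra hcon
    obtain ⟨n, hn1, hn2⟩ := (dense_orbit hα x).exists_mem_open
      (hU.inter (hC.isOpen_compl.preimage (continuous_add_const (x' - x)))) ⟨u, hu, hcon⟩
    apply hn2
    have : x + n • α + (x' - x) = x' + n • α := by abel
    change x + n • α + (x' - x) ∈ C
    rw [this]
    exact hUC n hn1
  have hs : ∀ j, s j = 0 ∨ s j = 1 := fun j => by omega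
  refine ⟨key _ _ isOpen_interior isClosed_closure fun n hn => ?_,
    key _ _ isOpen_interior isClosed_closure fun n hn => ?_⟩
  · rcases hs n with h0 | h1
    · have := (h n).2 h0
      rw [closure_compl] at this
      exact absurd hn this
    · exact (h' n).1 h1
  · rcases hs n with h0 | h1
    · exact (h' n).2 h0
    · have := (h n).1 h1
      rw [interior_compl] at hn
      exact absurd this hn

/-! ### Unique ergodicity -/

/-- An irrational rotation is uniquely ergodic. -/
theorem eq_volume_of_invariant (hα : DenseRange fun n : ℤ => n • α) (m : Measure UnitAddCircle)
    [IsProbabilityMeasure m] (hm : MeasurePreserving (· + α) m m) : m = volume := by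
  have hz : ∀ n : ℤ, MeasurePreserving (fun x => n • α + x) m m := by
    have hinv : MeasurePreserving (· + -α) m m := by
      have hmap : m.map (MeasurableEquiv.addRight α) = m := hm.map_eq
      refine ⟨by fun_prop, ?_⟩
      conv_lhs => rw [← hmap]
      rw [Measure.map_map (by fun_prop) (MeasurableEquiv.addRight α).measurable]
      convert Measure.map_id
      ext x; simp
    intro n
    induction n with
    | zero => simpa [Function.id_def] using MeasurePreserving.id m
    | succ n ih =>
      convert hm.comp ih using 1
      funext x; simp only [Function.comp, add_zsmul, one_zsmul]; abel
    | pred n ih =>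
      convert hinv.comp ih using 1
      funext x; simp only [Function.comp, sub_zsmul, one_zsmul]; abel
  have hleft : m.IsAddLeftInvariant := by
    refine ⟨fun g => ?_⟩
    have : IsProbabilityMeasure (m.map (g + ·)) :=
      Measure.isProbabilityMeasure_map (by fun_prop)
    refine ext_of_forall_integral_eq_of_IsFiniteMeasure fun f => ?_
    rw [integral_map (by fun_prop) f.continuous.aestronglyMeasurable]
    -- A continuous function of `g` that is constant on the dense set of multiples of `α` is
    -- constant. Hence `m` is invariant under all translations and uniqueness of Haar measure
    -- applies.
    have hc : Continuous fun g => ∫ x, f (g + x) ∂m := by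
      refine continuous_of_dominated (bound := fun _ => ‖f‖) (fun g => ?_) (fun g => ?_)
        (integrable_const _) ?_
      · exact Continuous.aestronglyMeasurable (by fun_prop)
      · exact Eventually.of_forall fun x => f.norm_coe_le_norm _
      · exact Eventually.of_forall fun x => by fun_prop
    refine congrFun (hα.equalizer hc (continuous_const (y := ∫ x, f x ∂m)) ?_) g
    funext n
    change ∫ x, f (n • α + x) ∂m = _
    rw [← integral_map (μ := m) (φ := fun x => n • α + x) (by fun_prop)
      f.continuous.aestronglyMeasurable, (hz n).map_eq]
    rfl
  have : m.IsAddHaarMeasure := Measure.isAddHaarMeasure_of_isCompact_nonempty_interior m univ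
    isCompact_univ (by simp) (by simp) (by simp)
  exact Measure.isAddHaarMeasure_eq_of_isProbabilityMeasure m volume

theorem measurable_itinerary (hX : MeasurableSet X) : Measurable (itinerary α X) := by
  classical
  refine measurable_pi_lambda _ fun i => ?_
  exact Measurable.ite (hX.preimage (by fun_prop)) measurable_const measurable_const

theorem ae_add_right {T : Type*} [AddGroup T] [MeasurableSpace T] [MeasurableAdd T]
    {m : Measure T} [m.IsAddRightInvariant] {p : T → Prop} (h : ∀ᵐ x ∂m, p x) (β : T) :
    ∀ᵐ x ∂m, p (x + β) :=
  ae_iff.2 ((measure_preimage_add_right m β {x | ¬p x}).trans (ae_iff.1 h))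

theorem ae_generic (hf : volume (frontier X) = 0) : ∀ᵐ x, x ∈ generic α X := by
  change ∀ᵐ x, ∀ i : ℤ, x + i • α ∉ frontier X
  rw [ae_all_iff]
  exact fun i => ae_add_right (p := (· ∉ frontier X)) (measure_eq_zero_iff_ae_notMem.1 hf) (i • α)

theorem generic_nonempty (hf : volume (frontier X) = 0) : (generic α X).Nonempty :=
  (ae_generic hf).exists

theorem dense_generic (hf : volume (frontier X) = 0) : Dense (generic α X) :=
  Measure.dense_of_ae (ae_generic hf)

theorem measurableSet_codingSet : MeasurableSet (codingSet α X) := isClosed_closure.measurableSet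

/-- Every invariant measure of the coding subshift is the distribution of the itinerary of a
uniformly distributed point. -/
theorem map_val_eq_of_invariant (hα : DenseRange fun n : ℤ => n • α) (hX : MeasurableSet X)
    (hf : volume (frontier X) = 0) (hsep : ∀ c, Matches X X c → c = 0)
    (ν : Measure (codingSet α X)) [IsProbabilityMeasure ν]
    (hν : MeasurePreserving (restrict shift (codingSet α X) shift_image_codingSet) ν ν) :
    ν.map Subtype.val = (volume : Measure UnitAddCircle).map (itinerary α X) := by
  choose π hπ using fun y : codingSet α X => exists_codes y.2
  have huniq : ∀ (y : codingSet α X) x, Codes α X x y → x = π y := fun y x h =>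
    sub_eq_zero.1 (hsep _ ((hπ y).matches hα h))
  -- By uniqueness, the preimage of a closed `C` is the projection of a closed set along the compact
  -- circle.
  have hcont : Continuous π := by
    rw [continuous_iff_isClosed]
    intro C hC
    have h1 : IsClosed (Prod.snd '' ({p : UnitAddCircle × (ℤ → Fin 2) | Codes α X p.1 p.2} ∩
        Prod.fst ⁻¹' C)) :=
      isClosedMap_snd_of_compactSpace _ (isClosed_codes.inter (hC.preimage continuous_fst))
    convert h1.preimage (continuous_subtype_val (p := (· ∈ codingSet α X))) using 1
    ext y
    constructor
    · intro hy; exact ⟨(π y, y), ⟨hπ y, hy⟩, rfl⟩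
    · rintro ⟨⟨x, s⟩, ⟨hx, hxC⟩, rfl : s = _⟩
      have := huniq y x hx
      subst this
      exact hxC
  have hequiv : ∀ y, π (restrict shift (codingSet α X) shift_image_codingSet y) = π y + α := by
    intro y
    symm
    apply huniq
    intro i
    have : π y + α + i • α = π y + (i + 1) • α := by rw [add_zsmul, one_zsmul]; abel
    rw [this]
    exact hπ y (i + 1)
  have hprob : IsProbabilityMeasure (ν.map π) :=
    Measure.isProbabilityMeasure_map hcont.measurable.aemeasurable
  have hvol : ν.map π = volume := by
    refine eq_volume_of_invariant hα _ ⟨by fun_prop, ?_⟩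
    rw [Measure.map_map (by fun_prop) hcont.measurable]
    conv_rhs => rw [← hν.map_eq]
    rw [Measure.map_map hcont.measurable hν.measurable]
    congr 1
    funext y
    exact (hequiv y).symm
  -- The image of `ν` under `π` is uniform, so `π y` is almost surely generic and then determines
  -- `y`.
  have hae : ∀ᵐ y : codingSet α X ∂ν, (y : ℤ → Fin 2) = itinerary α X (π y) := by
    have h1 : ∀ᵐ x ∂(ν.map π), x ∈ generic α X := hvol ▸ ae_generic hf
    filter_upwards [ae_of_ae_map hcont.measurable.aemeasurable h1] with y hy
    exact (hπ y).eq_itinerary hy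
  rw [Measure.map_congr hae, ← hvol, Measure.map_map (measurable_itinerary hX) hcont.measurable]
  rfl

theorem exists_invariant_codingSet (hX : MeasurableSet X) (hf : volume (frontier X) = 0) :
    ∃ ν : ProbabilityMeasure (codingSet α X), MeasurePreserving
      (restrict shift (codingSet α X) shift_image_codingSet) (ν : Measure (codingSet α X)) ν := by
  have hae : ∀ᵐ x, itinerary α X x ∈ codingSet α X :=
    (ae_generic hf).mono fun x hx => subset_closure ⟨x, hx, rfl⟩
  obtain ⟨x₀, hx₀⟩ := generic_nonempty (α := α) hf
  obtain ⟨J, hJm, hJ⟩ : ∃ J : UnitAddCircle → codingSet α X, Measurable J ∧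
      ∀ᵐ x, (J x : ℤ → Fin 2) = itinerary α X x := by
    classical
    have hm := measurable_itinerary (α := α) hX
    -- The itinerary of the generic point `x₀` serves as a default value on a null set, so that `J`
    -- lands in the subshift everywhere.
    refine ⟨fun x => ⟨if itinerary α X x ∈ codingSet α X then itinerary α X x
      else itinerary α X x₀, ?_⟩, ?_, ?_⟩
    · split_ifs with h
      exacts [h, subset_closure ⟨x₀, hx₀, rfl⟩]
    · exact (Measurable.ite (hm measurableSet_codingSet) hm measurable_const).subtype_mk
    · filter_upwards [hae] with x hx
      simp [hx]
  refine ⟨⟨volume.map J, Measure.isProbabilityMeasure_map hJm.aemeasurable⟩, ?_⟩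
  have hrm : Measurable (restrict shift (codingSet α X) shift_image_codingSet) :=
    (Homeomorph.continuous _).measurable
  refine ⟨hrm, ?_⟩
  change (volume.map J).map _ = volume.map J
  rw [Measure.map_map hrm hJm]
  have hmp := measurePreserving_add_right (volume : Measure UnitAddCircle) α
  conv_rhs => rw [← hmp.map_eq]
  rw [Measure.map_map hJm hmp.measurable]
  refine Measure.map_congr ?_
  filter_upwards [hJ, hmp.quasiMeasurePreserving.ae hJ] with x h1 h2
  apply Subtype.ext
  change shift (J x) = J (x + α)
  rw [h1, h2, itinerary_add]

theorem isStrictlyErgodicSet_codingSet (hα : DenseRange fun n : ℤ => n • α) (hX : MeasurableSet X)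
    (hf : volume (frontier X) = 0) (hsep : ∀ c, Matches X X c → c = 0) :
    IsStrictlyErgodicSet shift (codingSet α X) := by
  refine ⟨isClosed_closure.isCompact, shift_image_codingSet,
    isMinimal_codingSet hα (generic_nonempty hf), ?_⟩
  obtain ⟨ν, hν⟩ := exists_invariant_codingSet (α := α) hX hf
  refine ⟨ν, hν, fun ν' hν' => Subtype.ext ?_⟩
  have h := map_val_eq_of_invariant hα hX hf hsep (ν' : Measure (codingSet α X)) hν'
  rw [← map_val_eq_of_invariant hα hX hf hsep (ν : Measure (codingSet α X)) hν] at h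
  exact (MeasurableEmbedding.subtype_coe measurableSet_codingSet).map_injective h

/-- The coding subshift as a point of the space of strictly ergodic sets. -/
noncomputable def codingPoint (hα : DenseRange fun n : ℤ => n • α) (hX : MeasurableSet X)
    (hf : volume (frontier X) = 0) (hsep : ∀ c, Matches X X c → c = 0) :
    StrictlyErgodicSpace shift :=
  ⟨codingSet α X, isStrictlyErgodicSet_codingSet hα hX hf hsep⟩

theorem coe_measure_codingPoint (hα : DenseRange fun n : ℤ => n • α) (hX : MeasurableSet X)
    (hf : volume (frontier X) = 0) (hsep : ∀ c, Matches X X c → c = 0) :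
    ((codingPoint hα hX hf hsep).measure : Measure (ℤ → Fin 2)) =
      volume.map (itinerary α X) := by
  have h := (codingPoint hα hX hf hsep).2.2.choose_spec.2.exists.choose_spec
  unfold StrictlyErgodicSpace.measure
  -- `measure` is defined by choosing an invariant measure. The identity holds for every invariant
  -- measure, so the choice is immaterial.
  have key : ∀ ν : ProbabilityMeasure (codingSet α X), MeasurePreserving
      (restrict shift (codingSet α X) shift_image_codingSet) (ν : Measure (codingSet α X)) ν →
      (ν : Measure (codingSet α X)).map Subtype.val = volume.map (itinerary α X) :=
    fun ν hν => map_val_eq_of_invariant hα hX hf hsep ν hν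
  exact key _ h

theorem map_itinerary_compl_codingSet {α : UnitAddCircle} {X : Set UnitAddCircle}
    (hX : MeasurableSet X) (hf : volume (frontier X) = 0) :
    (volume.map (itinerary α X)) (codingSet α X)ᶜ = 0 := by
  rw [Measure.map_apply (measurable_itinerary hX) measurableSet_codingSet.compl]
  refine measure_eq_zero_iff_ae_notMem.2 ((ae_generic (α := α) hf).mono fun x hx hc => ?_)
  exact hc (subset_closure ⟨x, hx, rfl⟩)

/-! ### Continuous families of codings -/

section Family

variable {α : UnitAddCircle} {P : Type*} [TopologicalSpace P] {X : P → Set UnitAddCircle}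

theorem tendsto_itinerary
    (hloc : ∀ t, ∀ᵐ x, ∀ᶠ s in 𝓝 t, (x ∈ X s ↔ x ∈ X t)) (t : P) :
    ∀ᵐ x, Tendsto (fun s => itinerary α (X s) x) (𝓝 t) (𝓝 (itinerary α (X t) x)) := by
  have h : ∀ᵐ x : UnitAddCircle, ∀ i : ℤ, ∀ᶠ s in 𝓝 t, (x + i • α ∈ X s ↔ x + i • α ∈ X t) := by
    rw [ae_all_iff]
    exact fun i => ae_add_right (hloc t) (i • α)
  filter_upwards [h] with x hx
  rw [tendsto_pi_nhds]
  intro i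
  refine tendsto_nhds_of_eventually_eq ((hx i).mono fun s hs => ?_)
  classical exact if_congr hs rfl rfl

/-- A family of codings of an irrational rotation by sets that vary continuously in measure and
are pairwise inequivalent under translations is embedded in the space of strictly ergodic sets. -/
theorem isEmbedding_codingPoint [CompactSpace P] [FirstCountableTopology P]
    (hα : DenseRange fun n : ℤ => n • α) (hX : ∀ t, MeasurableSet (X t))
    (hf : ∀ t, volume (frontier (X t)) = 0)
    (hmatch : ∀ t t' c, Matches (X t) (X t') c → t = t' ∧ c = 0)
    (hloc : ∀ t, ∀ᵐ x, ∀ᶠ s in 𝓝 t, (x ∈ X s ↔ x ∈ X t)) :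
    IsEmbedding fun t => codingPoint hα (hX t) (hf t) fun c hc => (hmatch t t c hc).2 := by
  set f := fun t => codingPoint hα (hX t) (hf t) fun c hc => (hmatch t t c hc).2 with hfdef
  have hfm : ∀ t, ((f t).measure : Measure (ℤ → Fin 2)) = volume.map (itinerary α (X t)) :=
    fun t => coe_measure_codingPoint ..
  have hcont : Continuous fun t => (f t).measure := by
    rw [continuous_iff_continuousAt]
    intro t
    rw [ContinuousAt, ProbabilityMeasure.tendsto_iff_forall_integral_tendsto]
    intro φ
    have hint : ∀ s, ∫ ω, φ ω ∂((f s).measure : Measure (ℤ → Fin 2)) =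
        ∫ x, φ (itinerary α (X s) x) := fun s => by
      rw [hfm, integral_map (measurable_itinerary (hX s)).aemeasurable
        φ.continuous.aestronglyMeasurable]
    simp only [hint]
    refine tendsto_integral_filter_of_dominated_convergence (fun _ => ‖φ‖)
      (Eventually.of_forall fun s => ?_) (Eventually.of_forall fun s =>
        Eventually.of_forall fun x => φ.norm_coe_le_norm _) (integrable_const _) ?_
    · exact φ.continuous.aestronglyMeasurable.comp_aemeasurable
        (measurable_itinerary (hX s)).aemeasurable
    · filter_upwards [tendsto_itinerary (α := α) hloc t] with x hx
      exact (φ.continuous.tendsto _).comp hx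
  have hinj : Function.Injective fun t => (f t).measure := by
    intro t t' h
    have h1 := congrArg (fun m : ProbabilityMeasure (ℤ → Fin 2) => (m : Measure (ℤ → Fin 2))) h
    simp only [hfm] at h1
    have hc := map_itinerary_compl_codingSet (α := α) (hX t) (hf t)
    have hc' := map_itinerary_compl_codingSet (α := α) (hX t') (hf t')
    rw [← h1] at hc'
    have hp : IsProbabilityMeasure (volume.map (itinerary α (X t))) :=
      Measure.isProbabilityMeasure_map (measurable_itinerary (hX t)).aemeasurable
    -- The common law gives full measure to both subshifts, so they cannot be disjoint.
    obtain ⟨s, hs⟩ : (codingSet α (X t) ∩ codingSet α (X t')).Nonempty := by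
      by_contra hne
      rw [not_nonempty_iff_eq_empty] at hne
      have : (univ : Set (ℤ → Fin 2)) = (codingSet α (X t))ᶜ ∪ (codingSet α (X t'))ᶜ := by
        rw [← compl_inter, hne, compl_empty]
      have h0 := measure_univ (μ := volume.map (itinerary α (X t)))
      rw [this, measure_union_null hc hc'] at h0
      exact zero_ne_one h0
    obtain ⟨x, hx⟩ := exists_codes hs.1
    obtain ⟨x', hx'⟩ := exists_codes hs.2
    exact (hmatch t t' _ (hx.matches hα hx')).1
  exact IsEmbedding.of_comp (continuous_induced_rng.2 hcont) continuous_induced_dom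
    (hcont.isClosedEmbedding hinj).isEmbedding

end Family

/-! ### Block sets with prescribed lengths in dyadic windows -/

/-- The points `2⁻ᵏ / 8`. -/
noncomputable def scale (k : ℕ) : ℝ := (1 / 2) ^ k / 8

theorem scale_pos (k : ℕ) : 0 < scale k := by unfold scale; positivity

theorem two_mul_scale_succ (k : ℕ) : 2 * scale (k + 1) = scale k := by
  unfold scale; rw [pow_succ]; ring

theorem scale_antitone : Antitone scale :=
  antitone_nat_of_succ_le fun k => by linarith [two_mul_scale_succ k, scale_pos (k + 1)]

theorem two_mul_scale_le {m n : ℕ} (h : m < n) : 2 * scale n ≤ scale m := by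
  have := scale_antitone (Nat.succ_le_of_lt h)
  linarith [two_mul_scale_succ m]

theorem two_mul_scale_le_quarter (k : ℕ) : 2 * scale k ≤ 1 / 4 := by
  have := scale_antitone (Nat.zero_le k)
  simp only [scale, pow_zero] at this ⊢
  linarith

theorem tendsto_scale : Tendsto scale atTop (𝓝 0) := by
  have := (tendsto_pow_atTop_nhds_zero_of_lt_one (r := (1 / 2 : ℝ)) (by norm_num)
    (by norm_num)).div_const 8
  rw [zero_div] at this
  exact this

theorem exists_scale {r : ℝ} (h0 : 0 < r) (h1 : r ≤ 1 / 4) :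
    ∃ n, scale n < r ∧ r ≤ 2 * scale n := by
  obtain ⟨n, hn1, hn2⟩ := exists_nat_pow_near_of_lt_one (x := 4 * r) (y := (1 / 2 : ℝ))
    (by linarith) (by linarith) (by norm_num) (by norm_num)
  refine ⟨n, ?_, ?_⟩
  · rw [pow_succ] at hn1; unfold scale; linarith
  · unfold scale; linarith

/-- The union of the intervals `[2⁻ᵏ / 8, (1 + τ k) 2⁻ᵏ / 8)`, together with `0`. -/
def blocks (τ : ℕ → ℝ) : Set ℝ := {0} ∪ ⋃ k, Ico (scale k) (scale k * (1 + τ k))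

/-- The set `blocks τ` in the circle. -/
def circleBlocks (τ : ℕ → ℝ) : Set UnitAddCircle := (fun r : ℝ => (r : UnitAddCircle)) '' blocks τ

section Blocks

variable {τ τ' : ℕ → ℝ}

/-- Since `τ k ≤ 1`, block `k` stays inside its own window, and distinct windows are disjoint. -/
theorem mem_blocks_iff (hτ : ∀ k, τ k ≤ 1) {n : ℕ} {r : ℝ} (h1 : scale n ≤ r)
    (h2 : r < 2 * scale n) : r ∈ blocks τ ↔ r < scale n * (1 + τ n) := by
  constructor
  · rintro (h | h)
    · have := scale_pos n
      rw [mem_singleton_iff] at h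
      linarith
    · obtain ⟨m, hm1, hm2⟩ := mem_iUnion.1 h
      have hm3 : r < 2 * scale m := by nlinarith [scale_pos m, hτ m]
      rcases lt_trichotomy m n with hmn | rfl | hmn
      · linarith [two_mul_scale_le hmn]
      · exact hm2
      · linarith [two_mul_scale_le hmn]
  · exact fun h => Or.inr (mem_iUnion.2 ⟨n, h1, h⟩)

theorem blocks_subset (hτ : ∀ k, τ k ≤ 1) : blocks τ ⊆ Icc 0 (1 / 4) := by
  rintro r (h | h)
  · rw [mem_singleton_iff] at h; subst h; norm_num
  · obtain ⟨m, hm1, hm2⟩ := mem_iUnion.1 h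
    have := scale_pos m
    have := two_mul_scale_le_quarter m
    exact ⟨by linarith, by nlinarith [hτ m]⟩

theorem coe_injOn_Ico {r r' : ℝ} (hr : r ∈ Ico (0 : ℝ) 1) (hr' : r' ∈ Ico (0 : ℝ) 1)
    (h : (r : UnitAddCircle) = r') : r = r' :=
  (AddCircle.coe_eq_coe_iff_of_mem_Ico (p := (1 : ℝ)) (a := 0) (by simpa using hr)
    (by simpa using hr')).1 h

theorem coe_mem_circleBlocks (hτ : ∀ k, τ k ≤ 1) {r : ℝ} (hr : r ∈ Ico (0 : ℝ) 1) :
    (r : UnitAddCircle) ∈ circleBlocks τ ↔ r ∈ blocks τ := by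
  constructor
  · rintro ⟨r', hr', h⟩
    have h1 := blocks_subset hτ hr'
    have := coe_injOn_Ico ⟨h1.1, by linarith [h1.2]⟩ hr h
    exact this ▸ hr'
  · exact fun h => ⟨r, h, rfl⟩

instance : (𝓝[≠] (0 : UnitAddCircle)).NeBot := by
  rw [← mem_closure_iff_nhdsWithin_neBot]
  have h : Tendsto (fun n => (scale n : UnitAddCircle)) atTop (𝓝 ((0 : ℝ) : UnitAddCircle)) :=
    ((AddCircle.continuous_mk' (1 : ℝ)).tendsto 0).comp tendsto_scale
  refine mem_closure_of_tendsto h (Eventually.of_forall fun n hn => ?_)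
  have h1 := scale_pos n
  have h2 := two_mul_scale_le_quarter n
  have := coe_injOn_Ico (r' := 0) ⟨h1.le, by linarith⟩ (by simp) hn
  linarith

/-- The possible endpoints of the intervals in `blocks τ`. -/
def endpoints (τ : ℕ → ℝ) : Set ℝ :=
  {0} ∪ range (fun k => 2 * scale k) ∪ range (fun k => scale k * (1 + τ k))

theorem countable_endpoints (τ : ℕ → ℝ) : (endpoints τ).Countable :=
  ((countable_singleton 0).union (countable_range _)).union (countable_range _)

theorem cases_of_notMem_endpoints {r : ℝ} (hr : r ∈ Ico (0 : ℝ) 1)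
    (h : r ∉ endpoints τ) :
    1 / 4 < r ∨ ∃ n, scale n < r ∧ r < 2 * scale n ∧
      (r < scale n * (1 + τ n) ∨ scale n * (1 + τ n) < r) := by
  simp only [endpoints, mem_union, mem_singleton_iff, mem_range, not_or, not_exists] at h
  obtain ⟨⟨h0, h2⟩, h3⟩ := h
  refine or_iff_not_imp_left.2 fun h4 => ?_
  obtain ⟨n, hn1, hn2⟩ := exists_scale (lt_of_le_of_ne hr.1 (Ne.symm h0)) (not_lt.1 h4)
  exact ⟨n, hn1, lt_of_le_of_ne hn2 (Ne.symm (h2 n)), lt_or_gt_of_ne (Ne.symm (h3 n))⟩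

/-- Near a non-endpoint at most one window matters, hence at most one coordinate of `τ`, and
coordinates are continuous. Constancy is joint in parameter and point: a constant family yields the
countable frontier, and a fixed point yields stability under change of parameter. -/
theorem eventually_circleBlocks_iff {P : Type*} [TopologicalSpace P] {τ : P → ℕ → ℝ}
    (hc : Continuous τ) (hτ : ∀ t k, τ t k ≤ 1) (t : P) {r : ℝ} (hr : r ∈ Ico (0 : ℝ) 1)
    (h : r ∉ endpoints (τ t)) :
    ∀ᶠ p : P × UnitAddCircle in 𝓝 (t, (r : UnitAddCircle)),
      (p.2 ∈ circleBlocks (τ p.1) ↔ (r : UnitAddCircle) ∈ circleBlocks (τ t)) := by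
  have hopen : IsOpenMap (Prod.map id (fun r : ℝ => (r : UnitAddCircle)) :
      P × ℝ → P × UnitAddCircle) := IsOpenMap.id.prodMap QuotientAddGroup.isOpenMap_coe
  refine hopen.nhds_le (t, r) ?_
  rw [Filter.mem_map]
  have hfst : Continuous fun p : P × ℝ => p.2 := continuous_snd
  have hτc : ∀ n, Continuous fun p : P × ℝ => scale n * (1 + τ p.1 n) := fun n => by
    have := (continuous_apply n).comp hc
    exact (continuous_const.add (this.comp continuous_fst)).const_smul (scale n)
  have hpos : 0 < r := by
    refine lt_of_le_of_ne hr.1 fun h0 => h ?_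
    exact Or.inl (Or.inl h0.symm)
  have h01 : ∀ᶠ p : P × ℝ in 𝓝 (t, r), p.2 ∈ Ico (0 : ℝ) 1 := by
    filter_upwards [(isOpen_Ioo.preimage hfst).mem_nhds
      (show (t, r) ∈ _ from (⟨hpos, hr.2⟩ : r ∈ Ioo (0 : ℝ) 1))] with p hp
    exact ⟨hp.1.le, hp.2⟩
  have key : ∀ᶠ p : P × ℝ in 𝓝 (t, r), (p.2 ∈ blocks (τ p.1) ↔ r ∈ blocks (τ t)) := by
    rcases cases_of_notMem_endpoints hr h with h4 | ⟨n, h1, h2, h3⟩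
    · have h5 : r ∉ blocks (τ t) := fun hb => by linarith [(blocks_subset (hτ t) hb).2]
      filter_upwards [(isOpen_Ioi.preimage hfst).mem_nhds (show (t, r) ∈ _ from h4)] with p hp
      have h6 : p.2 ∉ blocks (τ p.1) := fun hb => by
        have := (blocks_subset (hτ p.1) hb).2
        have hp' : 1 / 4 < p.2 := hp
        linarith
      simp [h5, h6]
    · have hn : ∀ᶠ p : P × ℝ in 𝓝 (t, r), scale n < p.2 ∧ p.2 < 2 * scale n :=
        (isOpen_Ioo.preimage hfst).mem_nhds
          (show (t, r) ∈ _ from (⟨h1, h2⟩ : r ∈ Ioo (scale n) (2 * scale n)))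
      rcases h3 with h3 | h3
      · filter_upwards [hn, (isOpen_lt hfst (hτc n)).mem_nhds (show (t, r) ∈ _ from h3)]
          with p hp1 hp2
        rw [mem_blocks_iff (hτ t) h1.le h2, mem_blocks_iff (hτ p.1) hp1.1.le hp1.2]
        exact iff_of_true hp2 h3
      · filter_upwards [hn, (isOpen_lt (hτc n) hfst).mem_nhds (show (t, r) ∈ _ from h3)]
          with p hp1 hp2
        rw [mem_blocks_iff (hτ t) h1.le h2, mem_blocks_iff (hτ p.1) hp1.1.le hp1.2]
        exact iff_of_false (not_lt.2 (le_of_lt hp2)) (not_lt.2 h3.le)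
  filter_upwards [h01, key] with p hp1 hp2
  change ((p.2 : UnitAddCircle) ∈ circleBlocks (τ p.1) ↔ _)
  rw [coe_mem_circleBlocks (hτ p.1) hp1, coe_mem_circleBlocks (hτ t) hr, hp2]

theorem eventually_mem_circleBlocks_iff (hτ : ∀ k, τ k ≤ 1) {r : ℝ} (hr : r ∈ Ico (0 : ℝ) 1)
    (h : r ∉ endpoints τ) :
    ∀ᶠ x in 𝓝 (r : UnitAddCircle), (x ∈ circleBlocks τ ↔ (r : UnitAddCircle) ∈ circleBlocks τ) := by
  have h1 := eventually_circleBlocks_iff (P := Unit) (τ := fun _ => τ) continuous_const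
    (fun _ => hτ) () hr h
  have h2 : Continuous fun x : UnitAddCircle => ((), x) := by fun_prop
  exact (h2.tendsto _).eventually h1

theorem exists_coe_eq (x : UnitAddCircle) : ∃ r ∈ Ico (0 : ℝ) 1, (r : UnitAddCircle) = x := by
  have := AddCircle.coe_image_Ico_eq (1 : ℝ) 0
  rw [zero_add] at this
  exact (this ▸ mem_univ x : x ∈ _)

theorem frontier_circleBlocks_subset (hτ : ∀ k, τ k ≤ 1) :
    frontier (circleBlocks τ) ⊆ (fun r : ℝ => (r : UnitAddCircle)) '' endpoints τ := by
  intro x hx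
  obtain ⟨r, hr, rfl⟩ := exists_coe_eq x
  by_contra hcon
  have h1 := eventually_mem_circleBlocks_iff hτ hr fun h => hcon ⟨r, h, rfl⟩
  by_cases hmem : (r : UnitAddCircle) ∈ circleBlocks τ
  · exact hx.2 (mem_interior_iff_mem_nhds.2 (h1.mono fun x hx => hx.2 hmem))
  · have := mem_closure_iff_frequently.1 hx.1
    exact this (h1.mono fun x hx h => hmem (hx.1 h))

theorem countable_frontier_circleBlocks (hτ : ∀ k, τ k ≤ 1) :
    (frontier (circleBlocks τ)).Countable :=
  ((countable_endpoints τ).image _).mono (frontier_circleBlocks_subset hτ)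

theorem volume_frontier_circleBlocks (hτ : ∀ k, τ k ≤ 1) :
    volume (frontier (circleBlocks τ)) = 0 :=
  (countable_frontier_circleBlocks hτ).measure_zero _

theorem measurableSet_circleBlocks (hτ : ∀ k, τ k ≤ 1) : MeasurableSet (circleBlocks τ) := by
  rw [← union_sdiff_cancel (interior_subset (s := circleBlocks τ))]
  refine isOpen_interior.measurableSet.union
    ((countable_frontier_circleBlocks hτ).mono ?_).measurableSet
  exact fun x hx => ⟨subset_closure hx.1, hx.2⟩

theorem ae_eventually_circleBlocks {P : Type*} [TopologicalSpace P] {τ : P → ℕ → ℝ}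
    (hc : Continuous τ) (hτ : ∀ t k, τ t k ≤ 1) (t : P) :
    ∀ᵐ x, ∀ᶠ s in 𝓝 t, (x ∈ circleBlocks (τ s) ↔ x ∈ circleBlocks (τ t)) := by
  have h0 : ∀ᵐ x : UnitAddCircle, x ∉ (fun r : ℝ => (r : UnitAddCircle)) '' endpoints (τ t) :=
    measure_eq_zero_iff_ae_notMem.1 (((countable_endpoints (τ t)).image _).measure_zero _)
  filter_upwards [h0] with x hx
  obtain ⟨r, hr, rfl⟩ := exists_coe_eq x
  have h1 := eventually_circleBlocks_iff hc hτ t hr fun h => hx ⟨r, h, rfl⟩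
  have h2 : Continuous fun s : P => (s, (r : UnitAddCircle)) := by fun_prop
  exact (h2.tendsto t).eventually h1

theorem coe_mem_interior_circleBlocks {n : ℕ} {r : ℝ} (h1 : scale n < r)
    (h2 : r < scale n * (1 + τ n)) : (r : UnitAddCircle) ∈ interior (circleBlocks τ) := by
  have hsub : Ioo (scale n) (scale n * (1 + τ n)) ⊆ blocks τ := fun u hu =>
    Or.inr (mem_iUnion.2 ⟨n, hu.1.le, hu.2⟩)
  exact interior_maximal (image_mono hsub) (QuotientAddGroup.isOpenMap_coe _ isOpen_Ioo)
    ⟨r, ⟨h1, h2⟩, rfl⟩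

theorem coe_mem_interior_compl_circleBlocks (hτ : ∀ k, τ k ≤ 1) {n : ℕ} {r : ℝ}
    (h0 : scale n < r) (h1 : scale n * (1 + τ n) < r) (h2 : r < 2 * scale n) :
    (r : UnitAddCircle) ∈ interior (circleBlocks τ)ᶜ := by
  refine interior_maximal ?_ (QuotientAddGroup.isOpenMap_coe _
    (isOpen_Ioo (a := max (scale n) (scale n * (1 + τ n))) (b := 2 * scale n)))
    ⟨r, ⟨max_lt h0 h1, h2⟩, rfl⟩
  rintro _ ⟨u, ⟨hu1, hu2⟩, rfl⟩ hu
  have hu3 := scale_pos n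
  obtain ⟨hu4, hu5⟩ := max_lt_iff.1 hu1
  have := (coe_mem_circleBlocks hτ ⟨by linarith, by linarith [two_mul_scale_le_quarter n]⟩).1 hu
  rw [mem_blocks_iff hτ hu4.le hu2] at this
  linarith

theorem Matches.symm {X X' : Set UnitAddCircle} {c : UnitAddCircle} (h : Matches X X' c) :
    Matches X' X (-c) := by
  constructor
  · intro u hu
    by_contra hcon
    have h1 := h.2 (u + -c) (by rw [interior_compl]; exact hcon)
    rw [neg_add_cancel_right, closure_compl] at h1
    exact h1 hu
  · intro u hu
    by_contra hcon
    rw [closure_compl, notMem_compl_iff] at hcon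
    have h1 := h.1 _ hcon
    rw [neg_add_cancel_right] at h1
    rw [interior_compl] at hu
    exact hu h1

theorem closure_circleBlocks_subset (hτ : ∀ k, τ k ≤ 1) :
    closure (circleBlocks τ) ⊆ (fun r : ℝ => (r : UnitAddCircle)) '' Icc 0 (1 / 4) :=
  closure_minimal (image_mono (blocks_subset hτ))
    (isCompact_Icc.image (AddCircle.continuous_mk' 1)).isClosed

/-- The midpoints of the blocks are interior and tend to `0`, so their translates tend to `c` inside
the closure of `X'`. -/
theorem Matches.mem_closure_circleBlocks (hτ : ∀ k, τ k ≤ 1) (hτ0 : ∀ k, 0 < τ k)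
    {X' : Set UnitAddCircle} {c : UnitAddCircle} (h : Matches (circleBlocks τ) X' c) :
    c ∈ closure X' := by
  let m : ℕ → ℝ := fun n => scale n * (1 + τ n / 2)
  have hm : Tendsto m atTop (𝓝 0) := by
    refine squeeze_zero (g := fun n => 2 * scale n) (fun n => ?_) (fun n => ?_) ?_
    · have := scale_pos n; have := hτ0 n; positivity
    · change scale n * (1 + τ n / 2) ≤ 2 * scale n
      nlinarith [scale_pos n, hτ n]
    · simpa using tendsto_scale.const_mul 2
  have hm' : Tendsto (fun n => (m n : UnitAddCircle) + c) atTop (𝓝 c) := by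
    have := (((AddCircle.continuous_mk' (1 : ℝ)).tendsto 0).comp hm).add_const c
    simpa using this
  refine mem_closure_of_tendsto hm' (Eventually.of_forall fun n => ?_) |> fun h => by
    rwa [closure_closure] at h
  refine h.1 _ (coe_mem_interior_circleBlocks (n := n) ?_ ?_)
  · change scale n < scale n * (1 + τ n / 2); nlinarith [scale_pos n, hτ0 n]
  · change scale n * (1 + τ n / 2) < _; nlinarith [scale_pos n, hτ0 n]

/-- Both `c` and `-c` have representatives in `[0, 1/4]`. These add up to an integer that is at most
`1/2`, so both vanish. -/
theorem Matches.eq_zero (hτ : ∀ k, τ k ≤ 1) (hτ0 : ∀ k, 0 < τ k) (hτ' : ∀ k, τ' k ≤ 1)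
    (hτ0' : ∀ k, 0 < τ' k) {c : UnitAddCircle}
    (h : Matches (circleBlocks τ) (circleBlocks τ') c) : c = 0 := by
  obtain ⟨r, hr, hrc⟩ := closure_circleBlocks_subset hτ' (h.mem_closure_circleBlocks hτ hτ0)
  obtain ⟨r', hr', hrc'⟩ :=
    closure_circleBlocks_subset hτ (h.symm.mem_closure_circleBlocks hτ' hτ0')
  have hsum : ((r + r' : ℝ) : UnitAddCircle) = ((0 : ℝ) : UnitAddCircle) := by
    simp only at hrc hrc'
    rw [AddCircle.coe_add, hrc, hrc']; simp
  have := coe_injOn_Ico ⟨by linarith [hr.1, hr'.1], by linarith [hr.2, hr'.2]⟩ (by simp) hsum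
  have hr0 : r = 0 := by linarith [hr.1, hr'.1]
  rw [← hrc, hr0]; simp

/-- Otherwise the point midway between the ends of the two `k`-th blocks is interior to the larger
set and to the complement of the smaller. -/
theorem Matches.le_of_circleBlocks (hτ : ∀ k, τ k ≤ 1) (hτ0 : ∀ k, 0 < τ k)
    (hτ' : ∀ k, τ' k ≤ 1) (h : Matches (circleBlocks τ) (circleBlocks τ') 0) (k : ℕ) :
    τ' k ≤ τ k := by
  by_contra! hlt
  have hs := scale_pos k
  have h0 := hτ0 k
  have h1 := hτ' k
  set r := scale k * (1 + (τ k + τ' k) / 2) with hr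
  have e1 := h.2 r (coe_mem_interior_compl_circleBlocks hτ (n := k) (by nlinarith) (by nlinarith)
    (by nlinarith))
  rw [add_zero, closure_compl] at e1
  exact e1 (coe_mem_interior_circleBlocks (n := k) (by nlinarith) (by nlinarith))

theorem Matches.eq_of_circleBlocks (hτ : ∀ k, τ k ≤ 1) (hτ0 : ∀ k, 0 < τ k) (hτ' : ∀ k, τ' k ≤ 1)
    (hτ0' : ∀ k, 0 < τ' k) {c : UnitAddCircle}
    (h : Matches (circleBlocks τ) (circleBlocks τ') c) : τ = τ' ∧ c = 0 := by
  obtain rfl := h.eq_zero hτ hτ0 hτ' hτ0'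
  have h' := h.symm
  rw [neg_zero] at h'
  exact ⟨funext fun k => le_antisymm (h'.le_of_circleBlocks hτ' hτ0' hτ k)
    (h.le_of_circleBlocks hτ hτ0 hτ' k), rfl⟩

end Blocks

/-! ### The Hilbert cube -/

/-- A compact family of sets `circleBlocks (τ t)` gives an embedding into the space of strictly
ergodic sets. -/
theorem isEmbedding_circleBlocks {α : UnitAddCircle} (hα : DenseRange fun n : ℤ => n • α)
    {P : Type*} [TopologicalSpace P] [CompactSpace P] [FirstCountableTopology P]
    {τ : P → ℕ → ℝ} (hc : Continuous τ) (hinj : Function.Injective τ)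
    (hτ : ∀ t k, τ t k ≤ 1) (hτ0 : ∀ t k, 0 < τ t k) :
    IsEmbedding fun t => codingPoint hα (measurableSet_circleBlocks (hτ t))
      (volume_frontier_circleBlocks (hτ t)) fun _ hc =>
        (hc.eq_of_circleBlocks (hτ t) (hτ0 t) (hτ t) (hτ0 t)).2 :=
  isEmbedding_codingPoint hα (fun t => measurableSet_circleBlocks (hτ t))
    (fun t => volume_frontier_circleBlocks (hτ t))
    (fun t t' _ h => ⟨hinj (h.eq_of_circleBlocks (hτ t) (hτ0 t) (hτ t') (hτ0 t')).1,
      (h.eq_of_circleBlocks (hτ t) (hτ0 t) (hτ t') (hτ0 t')).2⟩)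
    (ae_eventually_circleBlocks hc hτ)

theorem denseRange_sqrt_two : DenseRange fun n : ℤ => n • ((√2 : ℝ) : UnitAddCircle) := by
  rw [AddCircle.denseRange_zsmul_coe_iff, div_one]
  exact irrational_sqrt_two

theorem exists_hilbertCube :
    ∃ K : Set (StrictlyErgodicSpace shift), Nonempty (K ≃ₜ (ℕ → unitInterval)) := by
  have h := isEmbedding_circleBlocks denseRange_sqrt_two
    -- The affine change of variable puts the fractions in `[1/2, 1]`, keeping them positive.
    (τ := fun (t : ℕ → unitInterval) k => (1 + (t k : ℝ)) / 2) (by fun_prop) (fun t t' h => by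
      funext k
      have := congrFun h k
      exact Subtype.ext (by linarith)) (fun t k => by have := (t k).2.2; linarith)
    (fun t k => by have := (t k).2.1; linarith)
  exact ⟨_, ⟨h.toHomeomorph.symm⟩⟩

/-! ### Opening gaps over a countable set -/

/-- A pair of one-sided continuous increasing functions of degree one whose common jumps, from
`lo x` to `hi x`, are exactly over the points of `O`. -/
structure GapFunctions (O : Set UnitAddCircle) where
  /-- The left-continuous version. -/
  lo : ℝ → ℝ
  /-- The right-continuous version. -/
  hi : ℝ → ℝ
  lo_add_one : ∀ x, lo (x + 1) = lo x + 1
  hi_add_one : ∀ x, hi (x + 1) = hi x + 1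
  lo_le_hi : ∀ x, lo x ≤ hi x
  lo_lt_hi_iff : ∀ x, lo x < hi x ↔ (x : UnitAddCircle) ∈ O
  hi_lt_lo : ∀ {x y}, x < y → hi x < lo y
  tendsto_hi : ∀ x, Tendsto hi (𝓝[>] x) (𝓝 (hi x))
  tendsto_lo : ∀ x, Tendsto lo (𝓝[<] x) (𝓝 (lo x))

theorem tendsto_fract_nhdsGT (v : ℝ) : Tendsto Int.fract (𝓝[>] v) (𝓝 (Int.fract v)) := by
  have h : Tendsto (fun u : ℝ => u - ⌊v⌋) (𝓝[>] v) (𝓝 (v - ⌊v⌋)) :=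
    (tendsto_id.sub_const _).mono_left nhdsWithin_le_nhds
  refine h.congr' ?_
  filter_upwards [Ioo_mem_nhdsGT (Int.lt_floor_add_one v)] with u hu
  have : ⌊u⌋ = ⌊v⌋ := Int.floor_eq_iff.2 ⟨(Int.floor_le v).trans hu.1.le, hu.2⟩
  rw [← this, Int.self_sub_floor]

theorem fract_le_one_sub_fract_neg (v : ℝ) : Int.fract v ≤ 1 - Int.fract (-v) := by
  rcases eq_or_ne (Int.fract v) 0 with h | h
  · rw [h]; linarith [Int.fract_lt_one (-v)]
  · rw [Int.fract_neg h]; linarith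

theorem fract_lt_one_sub_fract_neg_iff (v : ℝ) :
    Int.fract v < 1 - Int.fract (-v) ↔ Int.fract v = 0 := by
  constructor
  · intro h
    by_contra h0
    rw [Int.fract_neg h0] at h
    linarith
  · intro h
    rw [h]; linarith [Int.fract_lt_one (-v)]

/-- `1 - Int.fract (-v)` is the left limit of `Int.fract` at `v`. Since `Int.fract` has slope one
and only jumps down, its growth is at most `v - u`. -/
theorem one_sub_fract_neg_sub_fract_le {u v : ℝ} (h : u < v) :
    (1 - Int.fract (-v)) - Int.fract u ≤ v - u := by
  have h1 : ⌊u⌋ < ⌈v⌉ := Int.lt_ceil.2 ((Int.floor_le u).trans_lt h)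
  have h2 : (⌊u⌋ : ℝ) + 1 ≤ ⌈v⌉ := by exact_mod_cast h1
  have h3 : ((⌊-v⌋ : ℤ) : ℝ) = -⌈v⌉ := by rw [Int.floor_neg]; push_cast; rfl
  rw [← Int.self_sub_floor (-v), ← Int.self_sub_floor u, h3]
  linarith

theorem coe_eq_coe_iff_fract {x y : ℝ} :
    (x : UnitAddCircle) = y ↔ Int.fract (x - y) = 0 := by
  rw [← sub_eq_zero, ← AddCircle.coe_sub, AddCircle.coe_eq_zero_iff, Int.fract_eq_zero_iff]
  simp

theorem nonempty_gapFunctions {O : Set UnitAddCircle} (hO : O.Countable) :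
    Nonempty (GapFunctions O) := by
  obtain ⟨w, hw, c, hc, hc1⟩ := hO.exists_pos_hasSum_le (ε := 1 / 2) (by norm_num)
  choose rep hrep using fun q : UnitAddCircle => QuotientAddGroup.mk_surjective q
  have hrep' : ∀ q, ((rep q : ℝ) : UnitAddCircle) = q := hrep
  have hsum : ∀ f : O → ℝ, (∀ q, 0 ≤ f q) → (∀ q, f q ≤ 1) → Summable fun q : O => w q * f q :=
    fun f h0 h1 => Summable.of_nonneg_of_le (fun q => mul_nonneg (hw _).le (h0 q))
      (fun q => mul_le_of_le_one_right (hw _).le (h1 q)) hc.summable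
  have hs1 : ∀ x : ℝ, Summable fun q : O => w q * Int.fract (x - rep q) := fun x =>
    hsum _ (fun q => Int.fract_nonneg _) fun q => (Int.fract_lt_one _).le
  have hs2 : ∀ x : ℝ, Summable fun q : O => w q * (1 - Int.fract (-(x - rep q))) := fun x =>
    hsum _ (fun q => by linarith [Int.fract_lt_one (-(x - rep q))])
      fun q => by linarith [Int.fract_nonneg (-(x - rep q))]
  -- Each `Int.fract (x - rep q)` drops by `1` over `q`, so subtracting `w q` times it creates an
  -- upward jump of size `w q` there. The total weight is at most `1/2`, so `x` outweighs the linear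
  -- decrease and the functions remain strictly increasing.
  refine ⟨{
    lo := fun x => x - ∑' q : O, w q * (1 - Int.fract (-(x - rep q)))
    hi := fun x => x - ∑' q : O, w q * Int.fract (x - rep q)
    lo_add_one := fun x => ?_
    hi_add_one := fun x => ?_
    lo_le_hi := fun x => ?_
    lo_lt_hi_iff := fun x => ?_
    hi_lt_lo := fun {x y} hxy => ?_
    tendsto_hi := fun x => ?_
    tendsto_lo := fun x => ?_ }⟩
  · have : ∀ r : ℝ, Int.fract (-(x + 1 - r)) = Int.fract (-(x - r)) := fun r => by
      rw [show -(x + 1 - r) = -(x - r) - 1 by ring, Int.fract_sub_one]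
    simp only [this]; ring
  · have : ∀ r : ℝ, Int.fract (x + 1 - r) = Int.fract (x - r) := fun r => by
      rw [show x + 1 - r = (x - r) + 1 by ring, Int.fract_add_one]
    simp only [this]; ring
  · exact sub_le_sub_left ((hs1 x).tsum_le_tsum (fun q => mul_le_mul_of_nonneg_left
      (fract_le_one_sub_fract_neg _) (hw _).le) (hs2 x)) x
  · rw [sub_lt_sub_iff_left]
    constructor
    · intro h
      by_contra hx
      refine h.ne (tsum_congr fun q => ?_)
      congr 1
      refine le_antisymm (fract_le_one_sub_fract_neg _) (not_lt.1 fun hlt => ?_)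
      rw [fract_lt_one_sub_fract_neg_iff, ← coe_eq_coe_iff_fract, hrep'] at hlt
      exact hx (hlt ▸ q.2)
    · intro hx
      refine Summable.tsum_lt_tsum (i := ⟨_, hx⟩) (fun q => mul_le_mul_of_nonneg_left
        (fract_le_one_sub_fract_neg _) (hw _).le) ?_ (hs1 x) (hs2 x)
      refine mul_lt_mul_of_pos_left ?_ (hw _)
      rw [fract_lt_one_sub_fract_neg_iff, ← coe_eq_coe_iff_fract, hrep']
  · have h1 : ∑' q : O, w q * (1 - Int.fract (-(y - rep q))) ≤
        ∑' q : O, (w q * Int.fract (x - rep q) + w q * (y - x)) := by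
      refine (hs2 y).tsum_le_tsum (fun q => ?_) ((hs1 x).add (hc.summable.mul_right _))
      rw [← mul_add]
      refine mul_le_mul_of_nonneg_left ?_ (hw _).le
      have := one_sub_fract_neg_sub_fract_le (u := x - rep q) (v := y - rep q) (by linarith)
      linarith
    rw [(hs1 x).tsum_add (hc.summable.mul_right _), tsum_mul_right, hc.tsum_eq] at h1
    nlinarith
  · refine (tendsto_id.mono_left nhdsWithin_le_nhds).sub
      (tendsto_tsum_of_dominated_convergence hc.summable (fun q => ?_)
      (Eventually.of_forall fun u q => ?_))
    · refine Tendsto.const_mul _ ((tendsto_fract_nhdsGT _).comp ?_)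
      refine tendsto_nhdsWithin_iff.2 ⟨(tendsto_id.sub_const _).mono_left nhdsWithin_le_nhds, ?_⟩
      filter_upwards [self_mem_nhdsWithin] with u hu
      exact sub_lt_sub_right (mem_Ioi.1 hu) _
    · rw [Real.norm_of_nonneg (mul_nonneg (hw _).le (Int.fract_nonneg _))]
      exact mul_le_of_le_one_right (hw _).le (Int.fract_lt_one _).le
  · refine (tendsto_id.mono_left nhdsWithin_le_nhds).sub
      (tendsto_tsum_of_dominated_convergence hc.summable (fun q => ?_)
      (Eventually.of_forall fun u q => ?_))
    · refine Tendsto.const_mul _ (Tendsto.const_sub _ ((tendsto_fract_nhdsGT _).comp ?_))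
      refine tendsto_nhdsWithin_iff.2
        ⟨(tendsto_id.sub_const _).neg.mono_left nhdsWithin_le_nhds, ?_⟩
      filter_upwards [self_mem_nhdsWithin] with u hu
      exact neg_lt_neg (sub_lt_sub_right (mem_Iio.1 hu) _)
    · have h0 := Int.fract_nonneg (-(u - rep q))
      have h1 := Int.fract_lt_one (-(u - rep q))
      rw [Real.norm_of_nonneg (mul_nonneg (hw _).le (by linarith))]
      exact mul_le_of_le_one_right (hw _).le (by linarith)

/-- The homeomorphism of the circle induced by a degree one order isomorphism of the line. -/
def circleHomeo (e : ℝ ≃o ℝ) (he : ∀ x, e (x + 1) = e x + 1) : UnitAddCircle ≃ₜ UnitAddCircle :=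
  have he' : ∀ x, e.symm (x + 1) = e.symm x + 1 := fun x => by
    rw [OrderIso.symm_apply_eq, he, OrderIso.apply_symm_apply]
  have hp : Function.Periodic (fun x : ℝ => (e x : UnitAddCircle)) 1 := fun x => by simp [he]
  have hp' : Function.Periodic (fun x : ℝ => (e.symm x : UnitAddCircle)) 1 :=
    fun x => by simp [he']
  { toFun := hp.lift
    invFun := hp'.lift
    left_inv := fun q => by
      obtain ⟨x, rfl⟩ := QuotientAddGroup.mk_surjective q
      rw [hp.lift_coe]
      change hp'.lift ((e x : ℝ) : UnitAddCircle) = _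
      rw [hp'.lift_coe, e.symm_apply_apply]
    right_inv := fun q => by
      obtain ⟨x, rfl⟩ := QuotientAddGroup.mk_surjective q
      rw [hp'.lift_coe]
      change hp.lift ((e.symm x : ℝ) : UnitAddCircle) = _
      rw [hp.lift_coe, e.apply_symm_apply]
    continuous_toFun := by
      refine (QuotientAddGroup.isQuotientMap_mk _).continuous_iff.2 ?_
      exact (AddCircle.continuous_mk' (1 : ℝ)).comp e.continuous
    continuous_invFun := by
      refine (QuotientAddGroup.isQuotientMap_mk _).continuous_iff.2 ?_
      exact (AddCircle.continuous_mk' (1 : ℝ)).comp e.symm.continuous }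

theorem circleHomeo_coe (e : ℝ ≃o ℝ) (he : ∀ x, e (x + 1) = e x + 1) (x : ℝ) :
    circleHomeo e he (x : UnitAddCircle) = (e x : UnitAddCircle) := rfl

/-! ### The Denjoy homeomorphism and its rotation number -/

namespace GapFunctions

variable {O : Set UnitAddCircle} (Γ : GapFunctions O)

theorem strictMono_lo : StrictMono Γ.lo := fun _ _ h => (Γ.lo_le_hi _).trans_lt (Γ.hi_lt_lo h)

theorem strictMono_hi : StrictMono Γ.hi := fun _ _ h => (Γ.hi_lt_lo h).trans_le (Γ.lo_le_hi _)

theorem lo_add_intCast (x : ℝ) (n : ℤ) : Γ.lo (x + n) = Γ.lo x + n := by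
  induction n with
  | zero => simp
  | succ n ih => push_cast at ih ⊢; rw [← add_assoc, Γ.lo_add_one, ih]; ring
  | pred n ih =>
    push_cast at ih ⊢
    have := Γ.lo_add_one (x + (-n - 1))
    rw [show x + (-(n : ℝ) - 1) + 1 = x + -n by ring, ih] at this
    linarith

theorem hi_add_intCast (x : ℝ) (n : ℤ) : Γ.hi (x + n) = Γ.hi x + n := by
  induction n with
  | zero => simp
  | succ n ih => push_cast at ih ⊢; rw [← add_assoc, Γ.hi_add_one, ih]; ring
  | pred n ih =>
    push_cast at ih ⊢
    have := Γ.hi_add_one (x + (-n - 1))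
    rw [show x + (-(n : ℝ) - 1) + 1 = x + -n by ring, ih] at this
    linarith

/-- The supremum of the `u` with `lo u ≤ z` works, by left continuity of `lo` and right continuity
of `hi`. -/
theorem exists_mem_Icc (z : ℝ) : ∃ x, z ∈ Icc (Γ.lo x) (Γ.hi x) := by
  have hne : {u | Γ.lo u ≤ z}.Nonempty := by
    refine ⟨0 + (⌊z - Γ.lo 0⌋ : ℤ), ?_⟩
    rw [mem_ofPred_eq, Γ.lo_add_intCast]
    linarith [Int.floor_le (z - Γ.lo 0)]
  have hbdd : BddAbove {u | Γ.lo u ≤ z} := by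
    refine ⟨0 + (⌊z - Γ.lo 0⌋ + 1 : ℤ), fun u hu => ?_⟩
    rw [mem_ofPred_eq] at hu
    rw [← Γ.strictMono_lo.le_iff_le, Γ.lo_add_intCast]
    push_cast
    linarith [Int.lt_floor_add_one (z - Γ.lo 0)]
  refine ⟨sSup {u | Γ.lo u ≤ z}, ?_, ?_⟩
  · refine le_of_tendsto (Γ.tendsto_lo _) ?_
    filter_upwards [self_mem_nhdsWithin] with u hu
    obtain ⟨u', hu', hlt⟩ := exists_lt_of_lt_csSup hne hu
    exact (Γ.strictMono_lo hlt).le.trans hu'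
  · refine ge_of_tendsto (Γ.tendsto_hi _) ?_
    filter_upwards [self_mem_nhdsWithin] with u hu
    refine (not_le.1 fun h => ?_).le.trans (Γ.lo_le_hi u)
    exact absurd (le_csSup hbdd h) (not_le.2 hu)

theorem eq_of_mem_Icc {x y z : ℝ} (hx : z ∈ Icc (Γ.lo x) (Γ.hi x))
    (hy : z ∈ Icc (Γ.lo y) (Γ.hi y)) : x = y := by
  rcases lt_trichotomy x y with h | h | h
  · linarith [Γ.hi_lt_lo h, hx.2, hy.1]
  · exact h
  · linarith [Γ.hi_lt_lo h, hx.1, hy.2]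

/-- The map collapsing each gap. -/
noncomputable def collapse (z : ℝ) : ℝ := (Γ.exists_mem_Icc z).choose

theorem mem_Icc_collapse (z : ℝ) : z ∈ Icc (Γ.lo (Γ.collapse z)) (Γ.hi (Γ.collapse z)) :=
  (Γ.exists_mem_Icc z).choose_spec

theorem collapse_eq {x z : ℝ} (h : z ∈ Icc (Γ.lo x) (Γ.hi x)) : Γ.collapse z = x :=
  Γ.eq_of_mem_Icc (Γ.mem_Icc_collapse z) h

theorem monotone_collapse : Monotone Γ.collapse := by
  intro z z' h
  by_contra! hlt
  linarith [Γ.hi_lt_lo hlt, (Γ.mem_Icc_collapse z).1, (Γ.mem_Icc_collapse z').2]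

theorem collapse_add_one (z : ℝ) : Γ.collapse (z + 1) = Γ.collapse z + 1 := by
  apply Γ.collapse_eq
  rw [Γ.lo_add_one, Γ.hi_add_one]
  have := Γ.mem_Icc_collapse z
  exact ⟨by linarith [this.1], by linarith [this.2]⟩

/-- The lift of rotation by `β` that is affine on gaps. -/
noncomputable def lift (β z : ℝ) : ℝ :=
  Γ.lo (Γ.collapse z + β) + (Γ.hi (Γ.collapse z + β) - Γ.lo (Γ.collapse z + β)) *
    ((z - Γ.lo (Γ.collapse z)) / (Γ.hi (Γ.collapse z) - Γ.lo (Γ.collapse z)))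

theorem lift_eq {x z : ℝ} (β : ℝ) (h : z ∈ Icc (Γ.lo x) (Γ.hi x)) :
    Γ.lift β z = Γ.lo (x + β) + (Γ.hi (x + β) - Γ.lo (x + β)) *
      ((z - Γ.lo x) / (Γ.hi x - Γ.lo x)) := by
  rw [lift, Γ.collapse_eq h]

theorem lift_mem_Icc {x z : ℝ} (β : ℝ) (h : z ∈ Icc (Γ.lo x) (Γ.hi x)) :
    Γ.lift β z ∈ Icc (Γ.lo (x + β)) (Γ.hi (x + β)) := by
  rw [Γ.lift_eq β h]
  have h0 : 0 ≤ (z - Γ.lo x) / (Γ.hi x - Γ.lo x) :=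
    div_nonneg (by linarith [h.1]) (by linarith [Γ.lo_le_hi x])
  have h1 : (z - Γ.lo x) / (Γ.hi x - Γ.lo x) ≤ 1 :=
    div_le_one_of_le₀ (by linarith [h.2]) (by linarith [Γ.lo_le_hi x])
  have h2 := Γ.lo_le_hi (x + β)
  exact ⟨by nlinarith, by nlinarith⟩

theorem lift_add_one (β z : ℝ) : Γ.lift β (z + 1) = Γ.lift β z + 1 := by
  unfold lift
  rw [Γ.collapse_add_one, add_right_comm]
  simp only [Γ.lo_add_one, Γ.hi_add_one, add_sub_add_right_eq_sub]
  ring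

theorem lift_lo (β x : ℝ) : Γ.lift β (Γ.lo x) = Γ.lo (x + β) := by
  rw [Γ.lift_eq β ⟨le_rfl, Γ.lo_le_hi x⟩]; simp

section Invariant

variable {β : ℝ} (hβ : ∀ q : UnitAddCircle, q + (β : UnitAddCircle) ∈ O ↔ q ∈ O)
include hβ

theorem lo_lt_hi_add_iff (x : ℝ) : Γ.lo (x + β) < Γ.hi (x + β) ↔ Γ.lo x < Γ.hi x := by
  rw [Γ.lo_lt_hi_iff, Γ.lo_lt_hi_iff, AddCircle.coe_add, hβ]

theorem lift_hi (x : ℝ) : Γ.lift β (Γ.hi x) = Γ.hi (x + β) := by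
  rw [Γ.lift_eq β ⟨Γ.lo_le_hi x, le_rfl⟩]
  rcases (Γ.lo_le_hi x).eq_or_lt with h | h
  · have h' := mt (Γ.lo_lt_hi_add_iff hβ x).1 h.not_lt
    have := le_antisymm (Γ.lo_le_hi (x + β)) (not_lt.1 h')
    rw [this]; simp
  · rw [div_self (by linarith)]; ring

theorem strictMono_lift : StrictMono (Γ.lift β) := by
  intro z z' h
  have hz := Γ.mem_Icc_collapse z
  have hz' := Γ.mem_Icc_collapse z'
  rcases (Γ.monotone_collapse h.le).eq_or_lt with he | hlt
  · rw [← he] at hz'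
    rw [Γ.lift_eq β hz, Γ.lift_eq β hz']
    have h1 : Γ.lo (Γ.collapse z) < Γ.hi (Γ.collapse z) := by linarith [hz.1, hz'.2]
    have h2 := (Γ.lo_lt_hi_add_iff hβ _).2 h1
    have h3 := div_lt_div_of_pos_right (sub_lt_sub_right h (Γ.lo (Γ.collapse z)))
      (sub_pos.2 h1)
    have h4 := mul_lt_mul_of_pos_left h3 (sub_pos.2 h2)
    linarith
  · exact ((Γ.lift_mem_Icc β hz).2.trans_lt (Γ.hi_lt_lo (by linarith))).trans_le
      (Γ.lift_mem_Icc β hz').1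

theorem lift_neg_lift (z : ℝ) : Γ.lift (-β) (Γ.lift β z) = z := by
  have hz := Γ.mem_Icc_collapse z
  rw [Γ.lift_eq (-β) (Γ.lift_mem_Icc β hz), Γ.lift_eq β hz, add_neg_cancel_right]
  rcases (Γ.lo_le_hi (Γ.collapse z)).eq_or_lt with h | h
  · rw [h] at hz ⊢
    simp [le_antisymm hz.1 hz.2]
  · have h2 := (Γ.lo_lt_hi_add_iff hβ _).2 h
    have h3 := sub_ne_zero.2 h.ne'
    have h4 := sub_ne_zero.2 h2.ne'
    rw [add_sub_cancel_left, mul_div_cancel_left₀ _ h4, mul_div_cancel₀ _ h3]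
    ring

theorem lift_lift_neg (z : ℝ) : Γ.lift β (Γ.lift (-β) z) = z := by
  have := Γ.lift_neg_lift (β := -β) (fun q => by
    rw [← hβ, AddCircle.coe_neg, neg_add_cancel_right]) z
  rwa [neg_neg] at this

/-- The order isomorphism of the line lifting the Denjoy homeomorphism. -/
noncomputable def liftIso : ℝ ≃o ℝ :=
  (Γ.strictMono_lift hβ).orderIsoOfRightInverse _ (Γ.lift (-β)) (Γ.lift_lift_neg hβ)

theorem liftIso_apply (z : ℝ) : Γ.liftIso hβ z = Γ.lift β z := rfl

theorem liftIso_add_one (z : ℝ) : Γ.liftIso hβ (z + 1) = Γ.liftIso hβ z + 1 :=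
  Γ.lift_add_one β z

/-- The Denjoy homeomorphism of the circle. -/
noncomputable def denjoyHomeo : UnitAddCircle ≃ₜ UnitAddCircle :=
  circleHomeo (Γ.liftIso hβ) (Γ.liftIso_add_one hβ)

theorem denjoyHomeo_lo (x : ℝ) :
    Γ.denjoyHomeo hβ (Γ.lo x : UnitAddCircle) = (Γ.lo (x + β) : UnitAddCircle) := by
  rw [denjoyHomeo, circleHomeo_coe, liftIso_apply, lift_lo]

theorem denjoyHomeo_hi (x : ℝ) :
    Γ.denjoyHomeo hβ (Γ.hi x : UnitAddCircle) = (Γ.hi (x + β) : UnitAddCircle) := by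
  rw [denjoyHomeo, circleHomeo_coe, liftIso_apply, lift_hi Γ hβ]

theorem hasRotationNumber_denjoyHomeo : HasRotationNumber (Γ.denjoyHomeo hβ) β := by
  let F : CircleDeg1Lift := ⟨⟨Γ.lift β, (Γ.strictMono_lift hβ).monotone⟩, Γ.lift_add_one β⟩
  let p : CircleDeg1Lift := ⟨⟨Γ.collapse, Γ.monotone_collapse⟩, Γ.collapse_add_one⟩
  refine ⟨F, (Γ.liftIso hβ).continuous, fun x => rfl, ?_⟩
  -- Collapsing the gaps semiconjugates the lift to translation by `β`, and translation numbers are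
  -- preserved by such a semiconjugacy.
  have hsemi : Function.Semiconj p F (CircleDeg1Lift.translate (Multiplicative.ofAdd β)) := by
    intro z
    rw [CircleDeg1Lift.translate_apply]
    change Γ.collapse (Γ.lift β z) = β + Γ.collapse z
    rw [Γ.collapse_eq (Γ.lift_mem_Icc β (Γ.mem_Icc_collapse z)), add_comm]
  rw [CircleDeg1Lift.translationNumber_eq_of_semiconj hsemi,
    CircleDeg1Lift.translationNumber_translate]

end Invariant

end GapFunctions

/-! ### One-sided limits and the clopen partition of the Cantor set -/

/-- Points just to the left of `x` lie in `X`. -/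
def LeftMem (X : Set UnitAddCircle) (x : ℝ) : Prop := ∀ᶠ u : ℝ in 𝓝[<] x, (u : UnitAddCircle) ∈ X

/-- The indicator of `X` is right-continuous and has left limits. -/
structure IsCadlag (X : Set UnitAddCircle) : Prop where
  right : ∀ x : ℝ, ∀ᶠ u : ℝ in 𝓝[>] x, ((u : UnitAddCircle) ∈ X ↔ (x : UnitAddCircle) ∈ X)
  left : ∀ x : ℝ, ∀ᶠ u : ℝ in 𝓝[<] x, ((u : UnitAddCircle) ∈ X ↔ LeftMem X x)

theorem IsCadlag.leftMem_iff {X : Set UnitAddCircle} {x : ℝ}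
    (h : (x : UnitAddCircle) ∉ frontier X) : LeftMem X x ↔ (x : UnitAddCircle) ∈ X := by
  have hc : Tendsto (fun u : ℝ => (u : UnitAddCircle)) (𝓝[<] x) (𝓝 (x : UnitAddCircle)) :=
    ((AddCircle.continuous_mk' (1 : ℝ)).tendsto x).mono_left nhdsWithin_le_nhds
  constructor
  · intro hl
    by_contra hx
    have hcl : (x : UnitAddCircle) ∈ (closure X)ᶜ := fun hcl =>
      h ⟨hcl, fun hi => hx (interior_subset hi)⟩
    obtain ⟨u, hu1, hu2⟩ :=
      (hl.and (hc.eventually (isClosed_closure.isOpen_compl.mem_nhds hcl))).exists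
    exact hu2 (subset_closure hu1)
  · intro hx
    have hint : (x : UnitAddCircle) ∈ interior X := by
      by_contra hi; exact h ⟨subset_closure hx, hi⟩
    exact (hc.eventually (isOpen_interior.mem_nhds hint)).mono fun u hu => interior_subset hu

/-- Equal left limit and value would make membership in `X` locally constant at `x`. The genuine
jump is what later separates the codes of the two ends of a gap. -/
theorem IsCadlag.not_leftMem_iff {X : Set UnitAddCircle} (hX : IsCadlag X) {x : ℝ}
    (h : (x : UnitAddCircle) ∈ frontier X) : ¬(LeftMem X x ↔ (x : UnitAddCircle) ∈ X) := by
  intro hiff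
  have h1 : ∀ᶠ u : ℝ in 𝓝 x, ((u : UnitAddCircle) ∈ X ↔ (x : UnitAddCircle) ∈ X) := by
    rw [← nhdsLT_sup_nhdsGE, eventually_sup, ← nhdsGT_sup_nhdsWithin_singleton, eventually_sup]
    refine ⟨(hX.left x).mono fun u hu => hu.trans hiff, hX.right x, ?_⟩
    rw [nhdsWithin_singleton]
    exact (Iff.rfl : (x : UnitAddCircle) ∈ X ↔ _)
  have h2 : ∀ᶠ q in 𝓝 (x : UnitAddCircle), (q ∈ X ↔ (x : UnitAddCircle) ∈ X) :=
    QuotientAddGroup.isOpenMap_coe.nhds_le x h1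
  by_cases hmem : (x : UnitAddCircle) ∈ X
  · exact h.2 (mem_interior_iff_mem_nhds.2 (h2.mono fun x hx => hx.2 hmem))
  · exact mem_closure_iff_frequently.1 h.1 (h2.mono fun x hx h => hmem (hx.1 h))

theorem coe_eq_coe_iff {x y : ℝ} : (x : UnitAddCircle) = y ↔ ∃ n : ℤ, x = y + n := by
  rw [coe_eq_coe_iff_fract, Int.fract_eq_zero_iff]
  constructor
  · rintro ⟨n, hn⟩; exact ⟨n, by linarith⟩
  · rintro ⟨n, hn⟩; exact ⟨n, by rw [hn]; ring⟩

namespace GapFunctions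

variable {O : Set UnitAddCircle} (Γ : GapFunctions O)

theorem lo_eq_hi {x : ℝ} (h : (x : UnitAddCircle) ∉ O) : Γ.lo x = Γ.hi x :=
  le_antisymm (Γ.lo_le_hi x) (not_lt.1 (mt (Γ.lo_lt_hi_iff x).1 h))

theorem eq_of_lo_eq_hi {x y : ℝ} (h : Γ.lo x = Γ.hi y) : x = y :=
  Γ.eq_of_mem_Icc (z := Γ.lo x) ⟨le_rfl, Γ.lo_le_hi x⟩
    ⟨h ▸ Γ.lo_le_hi y, h.le⟩

/-- The Cantor set in the line consisting of all one-sided limits of the gap functions. -/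
def points : Set ℝ := range Γ.lo ∪ range Γ.hi

/-- The image of `points` in the circle. -/
def circlePoints : Set UnitAddCircle := (fun z : ℝ => (z : UnitAddCircle)) '' Γ.points

theorem hi_mem_points (x : ℝ) : Γ.hi x ∈ Γ.points := Or.inr ⟨x, rfl⟩

theorem lo_mem_points (x : ℝ) : Γ.lo x ∈ Γ.points := Or.inl ⟨x, rfl⟩

theorem add_intCast_mem_points {z : ℝ} (hz : z ∈ Γ.points) (n : ℤ) : z + n ∈ Γ.points := by
  rcases hz with ⟨x, rfl⟩ | ⟨x, rfl⟩
  · rw [← Γ.lo_add_intCast]; exact Γ.lo_mem_points _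
  · rw [← Γ.hi_add_intCast]; exact Γ.hi_mem_points _

theorem coe_mem_circlePoints {z : ℝ} : (z : UnitAddCircle) ∈ Γ.circlePoints ↔ z ∈ Γ.points := by
  constructor
  · rintro ⟨z', hz', h⟩
    obtain ⟨n, rfl⟩ := coe_eq_coe_iff.1 h.symm
    exact Γ.add_intCast_mem_points hz' n
  · exact fun h => ⟨z, h, rfl⟩

theorem hi_le_of_mem_points {x z : ℝ} (hz : z ∈ Γ.points) (h : Γ.lo x < z) : Γ.hi x ≤ z := by
  rcases hz with ⟨y, rfl⟩ | ⟨y, rfl⟩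
  · exact (Γ.hi_lt_lo (Γ.strictMono_lo.lt_iff_lt.1 h)).le
  · by_contra! hlt
    linarith [Γ.hi_lt_lo (Γ.strictMono_hi.lt_iff_lt.1 hlt)]

theorem le_lo_of_mem_points {x z : ℝ} (hz : z ∈ Γ.points) (h : z < Γ.hi x) : z ≤ Γ.lo x := by
  by_contra! hlt
  linarith [Γ.hi_le_of_mem_points hz hlt]

theorem isClosed_points : IsClosed Γ.points := by
  have : Γ.pointsᶜ = ⋃ x, Ioo (Γ.lo x) (Γ.hi x) := by
    ext z
    simp only [mem_compl_iff, mem_iUnion]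
    constructor
    · intro hz
      have h := Γ.mem_Icc_collapse z
      refine ⟨Γ.collapse z, lt_of_le_of_ne h.1 fun he => hz ?_, lt_of_le_of_ne h.2 fun he => hz ?_⟩
      · exact he ▸ Γ.lo_mem_points _
      · exact he ▸ Γ.hi_mem_points _
    · rintro ⟨x, hx⟩ hz
      linarith [Γ.hi_le_of_mem_points hz hx.1, hx.2]
  rw [← isOpen_compl_iff, this]
  exact isOpen_iUnion fun x => isOpen_Ioo

theorem isClosed_circlePoints : IsClosed Γ.circlePoints := by
  rw [← (QuotientAddGroup.isQuotientMap_mk (AddSubgroup.zmultiples (1 : ℝ))).isClosed_preimage]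
  convert Γ.isClosed_points using 1
  ext z
  exact Γ.coe_mem_circlePoints

/-- The part of `points` where the one-sided value of the indicator of `X` is one. -/
def upper (X : Set UnitAddCircle) : Set ℝ :=
  {z | ∃ x, (z = Γ.hi x ∧ (x : UnitAddCircle) ∈ X) ∨ (z = Γ.lo x ∧ LeftMem X x)}

section Upper

variable {X : Set UnitAddCircle}

theorem add_intCast_mem_upper {z : ℝ} (hz : z ∈ Γ.upper X) (n : ℤ) : z + n ∈ Γ.upper X := by
  obtain ⟨x, ⟨rfl, h⟩ | ⟨rfl, h⟩⟩ := hz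
  · exact ⟨x + n, Or.inl ⟨(Γ.hi_add_intCast x n).symm, by
      rwa [show ((x + n : ℝ) : UnitAddCircle) = x from coe_eq_coe_iff.2 ⟨n, rfl⟩]⟩⟩
  · refine ⟨x + n, Or.inr ⟨(Γ.lo_add_intCast x n).symm, ?_⟩⟩
    have ht : Tendsto (fun u : ℝ => u - n) (𝓝[<] (x + n)) (𝓝[<] x) := by
      refine tendsto_nhdsWithin_iff.2 ⟨?_, ?_⟩
      · have : Tendsto (fun u : ℝ => u - n) (𝓝 (x + n)) (𝓝 (x + n - n)) :=
          tendsto_id.sub_const _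
        rw [add_sub_cancel_right] at this
        exact this.mono_left nhdsWithin_le_nhds
      · filter_upwards [self_mem_nhdsWithin] with u hu
        rw [mem_Iio] at hu ⊢
        linarith
    refine (ht.eventually h).mono fun u hu => ?_
    rwa [show ((u - n : ℝ) : UnitAddCircle) = u from
      coe_eq_coe_iff.2 ⟨-n, by push_cast; ring⟩] at hu

theorem coe_mem_image_upper {z : ℝ} :
    (z : UnitAddCircle) ∈ (fun z : ℝ => (z : UnitAddCircle)) '' Γ.upper X ↔ z ∈ Γ.upper X := by
  constructor
  · rintro ⟨z', hz', h⟩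
    obtain ⟨n, rfl⟩ := coe_eq_coe_iff.1 h.symm
    exact Γ.add_intCast_mem_upper hz' n
  · exact fun h => ⟨z, h, rfl⟩

variable (hO : frontier X ⊆ O)
include hO

/-- The two clauses of `upper` can compete only when `lo x = hi x`. Then `x` is outside `O`, hence
off the frontier, and left limit and value agree. -/
theorem hi_mem_upper {x : ℝ} : Γ.hi x ∈ Γ.upper X ↔ (x : UnitAddCircle) ∈ X := by
  constructor
  · rintro ⟨y, ⟨h, hy⟩ | ⟨h, hy⟩⟩
    · rwa [Γ.strictMono_hi.injective h]
    · obtain rfl := Γ.eq_of_lo_eq_hi h.symm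
      rwa [← IsCadlag.leftMem_iff fun hf => ((Γ.lo_lt_hi_iff y).2 (hO hf)).ne h.symm]
  · exact fun h => ⟨x, Or.inl ⟨rfl, h⟩⟩

theorem lo_mem_upper {x : ℝ} : Γ.lo x ∈ Γ.upper X ↔ LeftMem X x := by
  constructor
  · rintro ⟨y, ⟨h, hy⟩ | ⟨h, hy⟩⟩
    · obtain rfl := Γ.eq_of_lo_eq_hi h
      rwa [IsCadlag.leftMem_iff fun hf => ((Γ.lo_lt_hi_iff x).2 (hO hf)).ne h]
    · rwa [Γ.strictMono_lo.injective h]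
  · exact fun h => ⟨x, Or.inr ⟨rfl, h⟩⟩

omit hO in
theorem leftMem_iff_of_forall_mem_Ioo {a b u : ℝ} {p : Prop}
    (h : ∀ v : ℝ, v ∈ Ioo a b → ((v : UnitAddCircle) ∈ X ↔ p)) (hu : u ∈ Ioc a b) :
    LeftMem X u ↔ p := by
  have h1 : ∀ᶠ v : ℝ in 𝓝[<] u, ((v : UnitAddCircle) ∈ X ↔ p) := by
    filter_upwards [Ioo_mem_nhdsLT hu.1] with v hv
    exact h v ⟨hv.1, hv.2.trans_le hu.2⟩
  constructor
  · intro hl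
    obtain ⟨v, hv1, hv2⟩ := (h1.and hl).exists
    exact hv1.1 hv2
  · exact fun hp => h1.mono fun v hv => hv.2 hp

theorem exists_right_nhd (hX : IsCadlag X) (x : ℝ) : ∃ b > Γ.hi x, ∀ z ∈ Γ.points,
    Γ.hi x ≤ z → z < b → (z ∈ Γ.upper X ↔ Γ.hi x ∈ Γ.upper X) := by
  obtain ⟨y, hy, hsub⟩ := mem_nhdsGT_iff_exists_Ioo_subset.1 (hX.right x)
  refine ⟨Γ.lo y, Γ.hi_lt_lo hy, ?_⟩
  rintro _ (⟨u, rfl⟩ | ⟨u, rfl⟩) h1 h2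
  · have huy := Γ.strictMono_lo.lt_iff_lt.1 h2
    rcases (Γ.strictMono_lo.le_iff_le.1 ((Γ.lo_le_hi x).trans h1)).eq_or_lt with rfl | hxu
    · rw [le_antisymm h1 (Γ.lo_le_hi x)]
    · rw [Γ.lo_mem_upper hO, Γ.hi_mem_upper hO]
      exact leftMem_iff_of_forall_mem_Ioo (fun v hv => hsub hv) ⟨hxu, huy.le⟩
  · have huy := Γ.strictMono_lo.lt_iff_lt.1 ((Γ.lo_le_hi u).trans_lt h2)
    rcases (Γ.strictMono_hi.le_iff_le.1 h1).eq_or_lt with rfl | hxu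
    · rfl
    · rw [Γ.hi_mem_upper hO, Γ.hi_mem_upper hO]
      exact hsub ⟨hxu, huy⟩

theorem exists_left_nhd (hX : IsCadlag X) (x : ℝ) : ∃ b < Γ.lo x, ∀ z ∈ Γ.points,
    b < z → z ≤ Γ.lo x → (z ∈ Γ.upper X ↔ Γ.lo x ∈ Γ.upper X) := by
  obtain ⟨y, hy, hsub⟩ := mem_nhdsLT_iff_exists_Ioo_subset.1 (hX.left x)
  refine ⟨Γ.hi y, Γ.hi_lt_lo hy, ?_⟩
  rintro _ (⟨u, rfl⟩ | ⟨u, rfl⟩) h1 h2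
  · have hyu := Γ.strictMono_hi.lt_iff_lt.1 (h1.trans_le (Γ.lo_le_hi u))
    rcases (Γ.strictMono_lo.le_iff_le.1 h2).eq_or_lt with rfl | hux
    · rfl
    · rw [Γ.lo_mem_upper hO, Γ.lo_mem_upper hO]
      exact leftMem_iff_of_forall_mem_Ioo (fun v hv => hsub hv) ⟨hyu, hux.le⟩
  · have hyu := Γ.strictMono_hi.lt_iff_lt.1 h1
    rcases (Γ.strictMono_hi.le_iff_le.1 (h2.trans (Γ.lo_le_hi x))).eq_or_lt with rfl | hux
    · rw [le_antisymm h2 (Γ.lo_le_hi u)]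
    · rw [Γ.hi_mem_upper hO, Γ.lo_mem_upper hO]
      exact hsub ⟨hyu, hux⟩

/-- At an end of a nontrivial gap one side contains no nearby points of the Cantor set, and the
one-sided limit controls the other. Where the gap is trivial, the two one-sided statements combine.
-/
theorem eventually_mem_upper_iff (hX : IsCadlag X) {z : ℝ} (hz : z ∈ Γ.points) :
    ∀ᶠ z' in 𝓝 z, z' ∈ Γ.points → (z' ∈ Γ.upper X ↔ z ∈ Γ.upper X) := by
  have hR : ∀ x, ∀ᶠ z' in 𝓝 (Γ.hi x), z' ∈ Γ.points → Γ.hi x ≤ z' →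
      (z' ∈ Γ.upper X ↔ Γ.hi x ∈ Γ.upper X) := fun x => by
    obtain ⟨b, hb, h⟩ := Γ.exists_right_nhd hO hX x
    filter_upwards [Iio_mem_nhds hb] with z' hz' hp hle using h z' hp hle hz'
  have hL : ∀ x, ∀ᶠ z' in 𝓝 (Γ.lo x), z' ∈ Γ.points → z' ≤ Γ.lo x →
      (z' ∈ Γ.upper X ↔ Γ.lo x ∈ Γ.upper X) := fun x => by
    obtain ⟨b, hb, h⟩ := Γ.exists_left_nhd hO hX x
    filter_upwards [Ioi_mem_nhds hb] with z' hz' hp hle using h z' hp hz' hle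
  rcases hz with ⟨x, rfl⟩ | ⟨x, rfl⟩
  · rcases (Γ.lo_le_hi x).eq_or_lt with he | hlt
    · have hR' := hR x
      rw [← he] at hR'
      filter_upwards [hL x, hR'] with z' h1 h2 hp
      rcases le_total z' (Γ.lo x) with h | h
      · exact h1 hp h
      · exact h2 hp h
    · filter_upwards [hL x, Iio_mem_nhds hlt] with z' h1 h2 hp
      exact h1 hp (Γ.le_lo_of_mem_points hp h2)
  · rcases (Γ.lo_le_hi x).eq_or_lt with he | hlt
    · have hL' := hL x
      rw [he] at hL'
      filter_upwards [hR x, hL'] with z' h1 h2 hp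
      rcases le_total z' (Γ.hi x) with h | h
      · exact h2 hp h
      · exact h1 hp h
    · filter_upwards [hR x, Ioi_mem_nhds hlt] with z' h1 h2 hp
      exact h1 hp (Γ.hi_le_of_mem_points hp h2)

theorem eventually_mem_image_upper_iff (hX : IsCadlag X) {m : UnitAddCircle}
    (hm : m ∈ Γ.circlePoints) :
    ∀ᶠ m' in 𝓝[Γ.circlePoints] m, (m' ∈ (fun z : ℝ => (z : UnitAddCircle)) '' Γ.upper X ↔
      m ∈ (fun z : ℝ => (z : UnitAddCircle)) '' Γ.upper X) := by
  obtain ⟨z, hz, rfl⟩ := hm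
  rw [eventually_nhdsWithin_iff]
  refine QuotientAddGroup.isOpenMap_coe.nhds_le z ?_
  rw [Filter.mem_map]
  filter_upwards [Γ.eventually_mem_upper_iff hO hX hz] with z' hz' hp
  refine Iff.trans ?_ Γ.coe_mem_image_upper.symm
  exact Γ.coe_mem_image_upper.trans (hz' (Γ.coe_mem_circlePoints.1 hp))

end Upper

end GapFunctions

/-! ### Symbolic codes and conjugacy with the Denjoy minimal set -/

theorem isMinimalSystem_of_conj {A B : Type*} [TopologicalSpace A] [TopologicalSpace B]
    {h : A ≃ₜ A} {g : B ≃ₜ B} (c : A ≃ₜ B) (hc : ∀ x, c (h x) = g (c x))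
    (hmin : IsMinimalSystem h) : IsMinimalSystem g := by
  have hinv : ∀ x, c (h⁻¹ x) = g⁻¹ (c x) := fun x => by
    apply g.injective
    rw [← hc, ← Homeomorph.mul_apply, ← Homeomorph.mul_apply]
    simp
  have hpow : ∀ (n : ℤ) x, c ((h ^ n) x) = (g ^ n) (c x) := by
    intro n
    induction n with
    | zero => simp
    | succ n ih =>
      intro x
      rw [zpow_add_one, zpow_add_one, Homeomorph.mul_apply, Homeomorph.mul_apply, ih, hc]
    | pred n ih =>
      intro x
      rw [zpow_sub_one, zpow_sub_one, Homeomorph.mul_apply, Homeomorph.mul_apply, ih, hinv]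
  refine ⟨hmin.1.map c, fun b => ?_⟩
  have h1 := c.surjective.denseRange.dense_image c.continuous (hmin.2 (c.symm b))
  rw [← range_comp] at h1
  convert h1 using 2
  funext n
  simp [hpow]

open Classical in
/-- The itinerary of `m` under `g` with respect to `A`. -/
noncomputable def symbolicCode {T : Type*} [TopologicalSpace T] (g : T ≃ₜ T) (A : Set T) (m : T) :
    ℤ → Fin 2 :=
  fun i => if (g ^ i) m ∈ A then 1 else 0

section SymbolicCode

variable {T : Type*} [TopologicalSpace T] {g : T ≃ₜ T} {A C : Set T}

theorem symbolicCode_apply_eq_one {m : T} {i : ℤ} :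
    symbolicCode g A m i = 1 ↔ (g ^ i) m ∈ A := by
  simp [symbolicCode]

theorem symbolicCode_apply_eq_zero {m : T} {i : ℤ} :
    symbolicCode g A m i = 0 ↔ (g ^ i) m ∉ A := by
  simp [symbolicCode]

theorem symbolicCode_apply_homeo (m : T) :
    symbolicCode g A (g m) = shift (symbolicCode g A m) := by
  funext i
  have h : (g ^ (i + 1)) m = (g ^ i) (g m) := by rw [zpow_add_one]; rfl
  simp only [symbolicCode, shift_apply]
  rw [h]

theorem zpow_mem_of_image_eq (hC : g '' C = C) {m : T} (hm : m ∈ C) (i : ℤ) : (g ^ i) m ∈ C := by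
  rw [← coe_restrict_zpow g C hC i ⟨m, hm⟩]
  exact Subtype.property _

theorem continuousOn_symbolicCode (hC : g '' C = C)
    (hA : ∀ m ∈ C, ∀ᶠ m' in 𝓝[C] m, (m' ∈ A ↔ m ∈ A)) : ContinuousOn (symbolicCode g A) C := by
  intro m hm
  refine tendsto_pi_nhds.2 fun i => tendsto_nhds_of_eventually_eq ?_
  have ht : Tendsto (g ^ i) (𝓝[C] m) (𝓝[C] ((g ^ i) m)) := by
    refine tendsto_nhdsWithin_iff.2
      ⟨((g ^ i).continuous.tendsto m).mono_left nhdsWithin_le_nhds, ?_⟩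
    filter_upwards [self_mem_nhdsWithin] with m' hm' using zpow_mem_of_image_eq hC hm' i
  filter_upwards [ht.eventually (hA _ (zpow_mem_of_image_eq hC hm i))] with m' hm'
  classical exact if_congr hm' rfl rfl

end SymbolicCode

theorem frequently_nhdsGT_of_dense {D : Set ℝ} (hD : Dense D) (x : ℝ) : ∃ᶠ u in 𝓝[>] x, u ∈ D := by
  rw [frequently_iff]
  intro U hU
  obtain ⟨y, hy, hsub⟩ := mem_nhdsGT_iff_exists_Ioo_subset.1 hU
  obtain ⟨u, hu1, hu2⟩ := hD.exists_mem_open isOpen_Ioo (nonempty_Ioo.2 hy)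
  exact ⟨u, hsub hu2, hu1⟩

theorem frequently_nhdsLT_of_dense {D : Set ℝ} (hD : Dense D) (x : ℝ) : ∃ᶠ u in 𝓝[<] x, u ∈ D := by
  rw [frequently_iff]
  intro U hU
  obtain ⟨y, hy, hsub⟩ := mem_nhdsLT_iff_exists_Ioo_subset.1 hU
  obtain ⟨u, hu1, hu2⟩ := hD.exists_mem_open isOpen_Ioo (nonempty_Ioo.2 hy)
  exact ⟨u, hsub hu2, hu1⟩

theorem compl_generic_add_iff {α : UnitAddCircle} {X : Set UnitAddCircle} (q : UnitAddCircle) :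
    q + α ∈ (generic α X)ᶜ ↔ q ∈ (generic α X)ᶜ := by
  rw [mem_compl_iff, mem_compl_iff, not_iff_not]
  constructor
  · intro h
    have := generic_add_zsmul h (-1)
    simpa using this
  · intro h
    simpa using generic_add_zsmul h 1

theorem countable_compl_generic {α : UnitAddCircle} {X : Set UnitAddCircle}
    (h : (frontier X).Countable) : (generic α X)ᶜ.Countable := by
  have : (generic α X)ᶜ = ⋃ i : ℤ, (fun q => q + i • α) ⁻¹' frontier X := by
    ext q
    simp [generic]
  rw [this]
  exact countable_iUnion fun i => h.preimage (add_left_injective (i • α))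

theorem frontier_subset_compl_generic {α : UnitAddCircle} {X : Set UnitAddCircle} :
    frontier X ⊆ (generic α X)ᶜ := fun q hq h => h 0 (by simpa using hq)

namespace GapFunctions

section Denjoy

variable {O : Set UnitAddCircle} (Γ : GapFunctions O) {β : ℝ}
  (hβ : ∀ q : UnitAddCircle, q + (β : UnitAddCircle) ∈ O ↔ q ∈ O)
include hβ

theorem denjoyHomeo_zpow_hi (i : ℤ) (x : ℝ) :
    (Γ.denjoyHomeo hβ ^ i) (Γ.hi x : UnitAddCircle) = (Γ.hi (x + i * β) : UnitAddCircle) := by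
  induction i generalizing x with
  | zero => simp
  | succ n ih =>
    rw [zpow_add_one, Homeomorph.mul_apply, denjoyHomeo_hi, ih]
    push_cast; ring_nf
  | pred n ih =>
    have h : (Γ.hi x : UnitAddCircle) = Γ.denjoyHomeo hβ (Γ.hi (x - β) : UnitAddCircle) := by
      rw [denjoyHomeo_hi, sub_add_cancel]
    rw [h, ← Homeomorph.mul_apply, ← zpow_add_one, sub_add_cancel, ih]
    push_cast; ring_nf

theorem denjoyHomeo_zpow_lo (i : ℤ) (x : ℝ) :
    (Γ.denjoyHomeo hβ ^ i) (Γ.lo x : UnitAddCircle) = (Γ.lo (x + i * β) : UnitAddCircle) := by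
  induction i generalizing x with
  | zero => simp
  | succ n ih =>
    rw [zpow_add_one, Homeomorph.mul_apply, denjoyHomeo_lo, ih]
    push_cast; ring_nf
  | pred n ih =>
    have h : (Γ.lo x : UnitAddCircle) = Γ.denjoyHomeo hβ (Γ.lo (x - β) : UnitAddCircle) := by
      rw [denjoyHomeo_lo, sub_add_cancel]
    rw [h, ← Homeomorph.mul_apply, ← zpow_add_one, sub_add_cancel, ih]
    push_cast; ring_nf

theorem denjoyHomeo_image_circlePoints :
    Γ.denjoyHomeo hβ '' Γ.circlePoints = Γ.circlePoints := by
  apply Subset.antisymm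
  · rintro _ ⟨_, ⟨_, ⟨x, rfl⟩ | ⟨x, rfl⟩, rfl⟩, rfl⟩
    · rw [denjoyHomeo_lo]; exact ⟨_, Γ.lo_mem_points _, rfl⟩
    · rw [denjoyHomeo_hi]; exact ⟨_, Γ.hi_mem_points _, rfl⟩
  · rintro _ ⟨_, ⟨x, rfl⟩ | ⟨x, rfl⟩, rfl⟩
    · exact ⟨_, ⟨_, Γ.lo_mem_points (x - β), rfl⟩, by rw [denjoyHomeo_lo, sub_add_cancel]⟩
    · exact ⟨_, ⟨_, Γ.hi_mem_points (x - β), rfl⟩, by rw [denjoyHomeo_hi, sub_add_cancel]⟩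

/-- The orbit of an end of a gap stays in the closed invariant set `circlePoints`, which misses the
midpoint of that gap. -/
theorem isDenjoyExample_denjoyHomeo (hirr : Irrational β) (hO : O.Nonempty) :
    IsDenjoyExample (Γ.denjoyHomeo hβ) := by
  refine ⟨⟨β, hirr, Γ.hasRotationNumber_denjoyHomeo hβ⟩, fun hmin => ?_⟩
  obtain ⟨q, hq⟩ := hO
  obtain ⟨x, rfl⟩ := QuotientAddGroup.mk_surjective q
  have hlt := (Γ.lo_lt_hi_iff x).2 hq
  have hd := hmin.2 (Γ.hi x : UnitAddCircle)
  have hsub : closure (range fun n : ℤ => (Γ.denjoyHomeo hβ ^ n) (Γ.hi x : UnitAddCircle)) ⊆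
      Γ.circlePoints := by
    refine closure_minimal ?_ Γ.isClosed_circlePoints
    rintro _ ⟨n, rfl⟩
    exact zpow_mem_of_image_eq (Γ.denjoyHomeo_image_circlePoints hβ)
      ⟨_, Γ.hi_mem_points x, rfl⟩ n
  have hmid := Γ.coe_mem_circlePoints.1 (hsub (hd (((Γ.lo x + Γ.hi x) / 2 : ℝ) : UnitAddCircle)))
  linarith [Γ.hi_le_of_mem_points (x := x) hmid (by linarith)]

end Denjoy

end GapFunctions

theorem coe_add_int_mul (x β : ℝ) (i : ℤ) :
    ((x + i * β : ℝ) : UnitAddCircle) = (x : UnitAddCircle) + i • (β : UnitAddCircle) := by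
  rw [AddCircle.coe_add, ← zsmul_eq_mul, AddCircle.coe_zsmul]

theorem LeftMem.mem_closure {X : Set UnitAddCircle} {x : ℝ} (h : LeftMem X x) :
    (x : UnitAddCircle) ∈ closure X :=
  mem_closure_of_tendsto (((AddCircle.continuous_mk' (1 : ℝ)).tendsto x).mono_left
    nhdsWithin_le_nhds) h

theorem IsCadlag.mem_closure_compl {X : Set UnitAddCircle} (hX : IsCadlag X) {x : ℝ}
    (h : ¬LeftMem X x) : (x : UnitAddCircle) ∈ closure Xᶜ :=
  LeftMem.mem_closure ((hX.left x).mono fun _ hu => mt hu.1 h)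

/-- The coding of an irrational rotation by a set with one-sided limits is a Denjoy minimal set. -/
theorem isDenjoyMinimalSet_codingSet {β : ℝ} (hirr : Irrational β) {X : Set UnitAddCircle}
    (hX : IsCadlag X) (hne : (frontier X).Nonempty) (hcount : (frontier X).Countable)
    (hsep : ∀ c, Matches X X c → c = 0) :
    IsDenjoyMinimalSet shift (codingSet (β : UnitAddCircle) X) := by
  set α : UnitAddCircle := (β : UnitAddCircle) with hαdef
  have hα : DenseRange fun n : ℤ => n • α := by
    rw [hαdef, AddCircle.denseRange_zsmul_coe_iff, div_one]
    exact hirr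
  have hvol : volume (frontier X) = 0 := hcount.measure_zero _
  have hO : frontier X ⊆ (generic α X)ᶜ := frontier_subset_compl_generic
  have hβ : ∀ q : UnitAddCircle, q + (β : UnitAddCircle) ∈ (generic α X)ᶜ ↔ q ∈ (generic α X)ᶜ :=
    compl_generic_add_iff
  obtain ⟨Γ⟩ := nonempty_gapFunctions (countable_compl_generic (α := α) hcount)
  set g := Γ.denjoyHomeo hβ with hg
  set M := Γ.circlePoints with hM
  have hgM : g '' M = M := Γ.denjoyHomeo_image_circlePoints hβ
  set A := (fun z : ℝ => (z : UnitAddCircle)) '' Γ.upper X with hA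
  set code := symbolicCode g A with hcode
  have hcont : ContinuousOn code M := continuousOn_symbolicCode hgM fun m hm =>
    Γ.eventually_mem_image_upper_iff hO hX hm
  have hiM : ∀ x, (Γ.hi x : UnitAddCircle) ∈ M := fun x => ⟨_, Γ.hi_mem_points x, rfl⟩
  have loM : ∀ x, (Γ.lo x : UnitAddCircle) ∈ M := fun x => ⟨_, Γ.lo_mem_points x, rfl⟩
  have hihi : ∀ (x : ℝ) (i : ℤ), (g ^ i) (Γ.hi x : UnitAddCircle) ∈ A ↔
      (x : UnitAddCircle) + i • α ∈ X := fun x i => by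
    rw [hg, Γ.denjoyHomeo_zpow_hi hβ, hA, Γ.coe_mem_image_upper, Γ.hi_mem_upper hO,
      coe_add_int_mul]
  have hilo : ∀ (x : ℝ) (i : ℤ), (g ^ i) (Γ.lo x : UnitAddCircle) ∈ A ↔
      LeftMem X (x + i * β) := fun x i => by
    rw [hg, Γ.denjoyHomeo_zpow_lo hβ, hA, Γ.coe_mem_image_upper, Γ.lo_mem_upper hO]
  have codehi : ∀ x : ℝ, code (Γ.hi x : UnitAddCircle) = itinerary α X (x : UnitAddCircle) :=
    fun x => by
      funext i
      classical exact if_congr (hihi x i) rfl rfl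
  have codes : ∀ m ∈ M, ∃ x : ℝ, (m = (Γ.hi x : UnitAddCircle) ∨ m = (Γ.lo x : UnitAddCircle)) ∧
      Codes α X (x : UnitAddCircle) (code m) := by
    rintro _ ⟨_, ⟨x, rfl⟩ | ⟨x, rfl⟩, rfl⟩
    · refine ⟨x, Or.inr rfl, fun i => ⟨fun h => ?_, fun h => ?_⟩⟩
      · rw [hcode, symbolicCode_apply_eq_one, hilo] at h
        rw [hαdef, ← coe_add_int_mul]
        exact h.mem_closure
      · rw [hcode, symbolicCode_apply_eq_zero, hilo] at h
        rw [hαdef, ← coe_add_int_mul]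
        exact hX.mem_closure_compl h
    · refine ⟨x, Or.inl rfl, ?_⟩
      change Codes α X x (code (Γ.hi x : UnitAddCircle))
      rw [codehi]
      exact codes_itinerary _
  have hdense : Dense {u : ℝ | (u : UnitAddCircle) ∈ generic α X} :=
    (dense_generic hvol).preimage QuotientAddGroup.isOpenMap_coe
  -- Generic points are dense from either side. A point `lo x` is approached through them from the
  -- left and `hi x` from the right, and their codes are itineraries.
  have hmem : ∀ m ∈ M, code m ∈ codingSet α X := by
    have hclosed : IsClosed (codingSet α X) := isClosed_closure
    have hcoe := AddCircle.continuous_mk' (1 : ℝ)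
    rintro _ ⟨_, ⟨x, rfl⟩ | ⟨x, rfl⟩, rfl⟩
    · have ht : Tendsto (fun u : ℝ => code (Γ.lo u : UnitAddCircle)) (𝓝[<] x)
          (𝓝 (code (Γ.lo x : UnitAddCircle))) :=
        (hcont _ (loM x)).tendsto.comp (tendsto_nhdsWithin_iff.2
          ⟨(hcoe.tendsto _).comp (Γ.tendsto_lo x), Eventually.of_forall fun u => loM u⟩)
      refine hclosed.closure_eq ▸ mem_closure_of_frequently_of_tendsto
        ((frequently_nhdsLT_of_dense hdense x).mono fun u hu => ?_) ht
      have hu' : (u : UnitAddCircle) ∉ (generic α X)ᶜ := fun h => h hu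
      rw [Γ.lo_eq_hi hu', codehi]
      exact subset_closure ⟨_, hu, rfl⟩
    · have ht : Tendsto (fun u : ℝ => code (Γ.hi u : UnitAddCircle)) (𝓝[>] x)
          (𝓝 (code (Γ.hi x : UnitAddCircle))) :=
        (hcont _ (hiM x)).tendsto.comp (tendsto_nhdsWithin_iff.2
          ⟨(hcoe.tendsto _).comp (Γ.tendsto_hi x), Eventually.of_forall fun u => hiM u⟩)
      refine hclosed.closure_eq ▸ mem_closure_of_frequently_of_tendsto
        ((frequently_nhdsGT_of_dense hdense x).mono fun u hu => ?_) ht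
      rw [codehi]
      exact subset_closure ⟨_, hu, rfl⟩
  have hne_code : ∀ x : ℝ, (Γ.hi x : UnitAddCircle) ≠ (Γ.lo x : UnitAddCircle) →
      code (Γ.hi x : UnitAddCircle) ≠ code (Γ.lo x : UnitAddCircle) := by
    intro x hx heq
    have hxO : (x : UnitAddCircle) ∈ (generic α X)ᶜ := by
      by_contra h
      exact hx (by rw [Γ.lo_eq_hi h])
    simp only [generic, mem_compl_iff, mem_ofPred_eq, not_forall, not_not] at hxO
    obtain ⟨i, hi⟩ := hxO
    rw [hαdef, ← coe_add_int_mul] at hi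
    refine hX.not_leftMem_iff hi ?_
    rw [← hilo, coe_add_int_mul, ← hihi]
    have h1 := congrFun heq i
    rw [hcode] at h1
    rw [← symbolicCode_apply_eq_one, ← symbolicCode_apply_eq_one, h1]
  -- Equal codes force the same base point by `hsep`. Two distinct ends of one gap differ at a time
  -- when the orbit meets the frontier.
  have hinj : InjOn code M := by
    intro m hm m' hm' heq
    obtain ⟨x, hx, hc⟩ := codes m hm
    obtain ⟨x', hx', hc'⟩ := codes m' hm'
    have hxx : (x' : UnitAddCircle) = x :=
      sub_eq_zero.1 (hsep _ ((heq ▸ hc : Codes α X x (code m')).matches hα hc'))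
    obtain ⟨n, rfl⟩ := coe_eq_coe_iff.1 hxx
    have hn : ∀ r : ℝ, ((r + n : ℝ) : UnitAddCircle) = r := fun r => coe_eq_coe_iff.2 ⟨n, rfl⟩
    rw [Γ.hi_add_intCast, Γ.lo_add_intCast, hn, hn] at hx'
    by_contra hmm
    rcases hx with rfl | rfl <;> rcases hx' with rfl | rfl
    · exact hmm rfl
    · exact hne_code x hmm heq
    · exact hne_code x (Ne.symm hmm) heq.symm
    · exact hmm rfl
  have hMc : IsCompact M := Γ.isClosed_circlePoints.isCompact
  have hsurj : SurjOn code M (codingSet α X) := by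
    refine closure_minimal ?_ (hMc.image_of_continuousOn hcont).isClosed
    rintro _ ⟨q, -, rfl⟩
    obtain ⟨x, rfl⟩ := QuotientAddGroup.mk_surjective q
    exact ⟨_, hiM x, codehi x⟩
  have : CompactSpace M := isCompact_iff_compactSpace.1 hMc
  let e : M ≃ codingSet α X := (BijOn.mk hmem hinj hsurj).equiv code
  have he : Continuous e := hcont.domRestrict.subtype_mk _
  let Φ : M ≃ₜ codingSet α X := he.homeoOfEquivCompactToT2
  have hΦ : ∀ m : M, ((Φ m : codingSet α X) : ℤ → Fin 2) = code m := fun m => rfl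
  have hconj : ∀ m : M, Φ (restrict g M hgM m) =
      restrict shift (codingSet α X) shift_image_codingSet (Φ m) := fun m => by
    apply Subtype.ext
    rw [hΦ]
    change code (g m) = shift (Φ m)
    rw [hΦ]
    exact symbolicCode_apply_homeo _
  have hconj' : ∀ y, Φ.symm (restrict shift (codingSet α X) shift_image_codingSet y) =
      restrict g M hgM (Φ.symm y) := fun y => by
    rw [Homeomorph.symm_apply_eq, hconj, Homeomorph.apply_symm_apply]
  refine ⟨isClosed_closure.isCompact, shift_image_codingSet, g,
    Γ.isDenjoyExample_denjoyHomeo hβ hirr (hne.mono hO), M, hgM, ⟨hMc, hgM, ?_⟩, Φ.symm, hconj'⟩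
  -- Minimality of `M` is carried back from the coding subshift through the conjugacy.
  exact isMinimalSystem_of_conj Φ.symm hconj' (isMinimal_codingSet hα (generic_nonempty hvol))

/-! ### Block sets with one-sided limits, and the balls -/

theorem IsCadlag.of_fundamentalDomain {X : Set UnitAddCircle}
    (hr : ∀ r ∈ Ico (0 : ℝ) 1, ∃ b > r, ∀ u ∈ Ioo r b,
      ((u : UnitAddCircle) ∈ X ↔ (r : UnitAddCircle) ∈ X))
    (hl : ∀ r ∈ Ioc (0 : ℝ) 1, ∃ b < r, ∃ p : Prop, ∀ u ∈ Ioo b r,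
      ((u : UnitAddCircle) ∈ X ↔ p)) : IsCadlag X := by
  have hcoe : ∀ (u : ℝ) (m : ℤ), ((u - m : ℝ) : UnitAddCircle) = u := fun u m =>
    coe_eq_coe_iff.2 ⟨-m, by push_cast; ring⟩
  constructor
  · intro x
    obtain ⟨b, hb, h⟩ := hr (x - ⌊x⌋)
      ⟨by linarith [Int.floor_le x], by linarith [Int.lt_floor_add_one x]⟩
    filter_upwards [Ioo_mem_nhdsGT (show x < b + ⌊x⌋ by linarith)] with u hu
    have := h (u - ⌊x⌋) ⟨by linarith [hu.1], by linarith [hu.2]⟩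
    rwa [hcoe, hcoe] at this
  · intro x
    -- Subtracting `⌈x⌉ - 1` rather than the floor puts `x` in `(0, 1]`, where left neighbourhoods
    -- do not cross the seam.
    obtain ⟨b, hb, p, h⟩ := hl (x - (⌈x⌉ - 1 : ℤ)) (by
      push_cast
      exact ⟨by linarith [Int.ceil_lt_add_one x], by linarith [Int.le_ceil x]⟩)
    have h' : ∀ v : ℝ, v ∈ Ioo (b + (⌈x⌉ - 1 : ℤ)) x → ((v : UnitAddCircle) ∈ X ↔ p) :=
      fun v hv => by
        have := h (v - (⌈x⌉ - 1 : ℤ)) ⟨by linarith [hv.1], by linarith [hv.2]⟩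
        rwa [hcoe] at this
    have hbx : b + (⌈x⌉ - 1 : ℤ) < x := by linarith
    filter_upwards [Ioo_mem_nhdsLT hbx] with u hu
    rw [GapFunctions.leftMem_iff_of_forall_mem_Ioo h' ⟨hbx, le_rfl⟩]
    exact h' u hu

section Blocks

variable {τ : ℕ → ℝ}

theorem lt_quarter_of_mem_blocks (hτ : ∀ k, τ k ≤ 1) {r : ℝ} (h : r ∈ blocks τ) : r < 1 / 4 := by
  rcases h with h | h
  · rw [mem_singleton_iff] at h; linarith
  · obtain ⟨m, -, hm⟩ := mem_iUnion.1 h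
    nlinarith [hτ m, scale_pos m, two_mul_scale_le_quarter m]

theorem exists_scale_le {r : ℝ} (h0 : 0 < r) (h1 : r < 1 / 4) :
    ∃ n, scale n ≤ r ∧ r < 2 * scale n := by
  obtain ⟨n, hn1, hn2⟩ := exists_scale h0 h1.le
  rcases hn2.eq_or_lt with h | h
  · cases n with
    | zero => simp only [scale] at h; linarith
    | succ n =>
      rw [two_mul_scale_succ] at h
      exact ⟨n, h.ge, by linarith [scale_pos n]⟩
  · exact ⟨n, hn1.le, h⟩

theorem mem_blocks_of_lt {n : ℕ} (hn : ∀ k, n ≤ k → τ k = 1) {u : ℝ} (h0 : 0 < u)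
    (h1 : u < 2 * scale n) : u ∈ blocks τ := by
  obtain ⟨k, hk1, hk2⟩ := exists_scale_le h0 (h1.trans_le (two_mul_scale_le_quarter n))
  have hkn : n ≤ k := by
    by_contra! hlt
    linarith [two_mul_scale_le hlt]
  refine Or.inr (mem_iUnion.2 ⟨k, hk1, ?_⟩)
  rw [hn k hkn]; linarith

/-- Blocks accumulate only at `0` from the right. There the full blocks `k ≥ n` abut and fill `(0, 2
* scale n)`, so the right limit exists and agrees with the membership of `0`. -/
theorem isCadlag_circleBlocks (hτ : ∀ k, τ k ≤ 1) (hτ0 : ∀ k, 0 < τ k) {n : ℕ}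
    (hn : ∀ k, n ≤ k → τ k = 1) : IsCadlag (circleBlocks τ) := by
  refine IsCadlag.of_fundamentalDomain (fun r hr => ?_) fun r hr => ?_
  · suffices ∃ b > r, b ≤ 1 ∧ ∀ u ∈ Ioo r b, (u ∈ blocks τ ↔ r ∈ blocks τ) by
      obtain ⟨b, hb, hb1, h⟩ := this
      refine ⟨b, hb, fun u hu => ?_⟩
      rw [coe_mem_circleBlocks hτ ⟨hr.1.trans hu.1.le, hu.2.trans_le hb1⟩,
        coe_mem_circleBlocks hτ hr, h u hu]
    rcases hr.1.eq_or_lt with rfl | h0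
    · have h1 := scale_pos n
      refine ⟨2 * scale n, by linarith, by linarith [two_mul_scale_le_quarter n], fun u hu => ?_⟩
      exact iff_of_true (mem_blocks_of_lt hn hu.1 hu.2) (Or.inl rfl)
    rcases lt_or_ge r (1 / 4) with h1 | h1
    · obtain ⟨k, hk1, hk2⟩ := exists_scale_le h0 h1
      have hk3 := two_mul_scale_le_quarter k
      have hk4 : scale k * (1 + τ k) ≤ 2 * scale k := by nlinarith [scale_pos k, hτ k]
      rcases lt_or_ge r (scale k * (1 + τ k)) with h2 | h2
      · refine ⟨_, h2, by linarith, fun u hu => ?_⟩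
        rw [mem_blocks_iff hτ (hk1.trans hu.1.le) (hu.2.trans_le hk4),
          mem_blocks_iff hτ hk1 hk2]
        exact iff_of_true hu.2 h2
      · refine ⟨_, hk2, by linarith, fun u hu => ?_⟩
        rw [mem_blocks_iff hτ (hk1.trans hu.1.le) hu.2, mem_blocks_iff hτ hk1 hk2]
        exact iff_of_false (by linarith [hu.1]) (by linarith)
    · refine ⟨1, hr.2, le_rfl, fun u hu => iff_of_false (fun h => ?_) fun h => ?_⟩
      · linarith [hu.1, lt_quarter_of_mem_blocks hτ h]
      · linarith [lt_quarter_of_mem_blocks hτ h]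
  · suffices ∃ b < r, 0 ≤ b ∧ ∃ p : Prop, ∀ u ∈ Ioo b r, (u ∈ blocks τ ↔ p) by
      obtain ⟨b, hb, hb1, p, h⟩ := this
      refine ⟨b, hb, p, fun u hu => ?_⟩
      rw [coe_mem_circleBlocks hτ ⟨hb1.trans hu.1.le, hu.2.trans_le hr.2⟩, h u hu]
    rcases le_or_gt r (1 / 4) with h1 | h1
    · obtain ⟨k, hk1, hk2⟩ := exists_scale hr.1 h1
      have hk3 := scale_pos k
      rcases le_or_gt r (scale k * (1 + τ k)) with h2 | h2
      · refine ⟨scale k, hk1, hk3.le, True, fun u hu => ?_⟩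
        rw [mem_blocks_iff hτ hu.1.le (hu.2.trans_le hk2)]
        exact iff_of_true (hu.2.trans_le h2) trivial
      · refine ⟨scale k * (1 + τ k), h2, by nlinarith [hτ0 k], False, fun u hu => ?_⟩
        rw [mem_blocks_iff hτ (by nlinarith [hτ0 k, hu.1]) (hu.2.trans_le hk2)]
        exact iff_of_false (by linarith [hu.1]) id
    · refine ⟨1 / 4, h1, by norm_num, False, fun u hu => iff_of_false (fun h => ?_) id⟩
      linarith [hu.1, lt_quarter_of_mem_blocks hτ h]

theorem zero_mem_frontier_circleBlocks (hτ : ∀ k, τ k ≤ 1) :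
    ((0 : ℝ) : UnitAddCircle) ∈ frontier (circleBlocks τ) := by
  by_contra hcon
  have hl := (IsCadlag.leftMem_iff hcon).2 ⟨0, Or.inl rfl, rfl⟩
  obtain ⟨u, hu1, hu2⟩ :=
    (Filter.Eventually.and hl (Ioo_mem_nhdsLT (show (-1 / 2 : ℝ) < 0 by norm_num))).exists
  rw [show (u : UnitAddCircle) = ((u + 1 : ℝ) : UnitAddCircle) from
    coe_eq_coe_iff.2 ⟨-1, by push_cast; ring⟩,
    coe_mem_circleBlocks hτ ⟨by linarith [hu2.1], by linarith [hu2.2]⟩] at hu1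
  linarith [lt_quarter_of_mem_blocks hτ hu1, hu2.1]

end Blocks

theorem exists_denjoyBall (n : ℕ) : ∃ B : Set (denjoySpace shift),
    Nonempty (B ≃ₜ Metric.closedBall (0 : EuclideanSpace ℝ (Fin n)) 1) := by
  -- Coordinates in `[-1, 1]` become fractions in `[1/4, 3/4]`. The constant tail `1` is what
  -- `isCadlag_circleBlocks` requires.
  let τ : Metric.closedBall (0 : EuclideanSpace ℝ (Fin n)) 1 → ℕ → ℝ := fun x k =>
    if h : k < n then (x.1 ⟨k, h⟩ + 2) / 4 else 1
  have hx : ∀ (x : Metric.closedBall (0 : EuclideanSpace ℝ (Fin n)) 1) i, |x.1 i| ≤ 1 :=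
    fun x i => (PiLp.norm_apply_le x.1 i).trans (mem_closedBall_zero_iff.1 x.2)
  have hτ : ∀ x k, τ x k ≤ 1 := fun x k => by
    by_cases h : k < n
    · simp only [τ, h, dite_true]
      linarith [(abs_le.1 (hx x ⟨k, h⟩)).2]
    · simp [τ, h]
  have hτ0 : ∀ x k, 0 < τ x k := fun x k => by
    by_cases h : k < n
    · simp only [τ, h, dite_true]
      linarith [(abs_le.1 (hx x ⟨k, h⟩)).1]
    · simp [τ, h]
  have hc : Continuous τ := by
    refine continuous_pi fun k => ?_
    by_cases h : k < n
    · simp only [τ, h, dite_true]; fun_prop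
    · simp only [τ, h, dite_false]; fun_prop
  have hinj : Function.Injective τ := fun x y hxy => by
    apply Subtype.ext
    ext i
    have := congrFun hxy i
    simp only [τ, i.2, dite_true] at this
    linarith
  have hemb := isEmbedding_circleBlocks denseRange_sqrt_two hc hinj hτ hτ0
  have hmem : ∀ x, codingPoint denseRange_sqrt_two (measurableSet_circleBlocks (hτ x))
      (volume_frontier_circleBlocks (hτ x)) (fun _ hc =>
        (hc.eq_of_circleBlocks (hτ x) (hτ0 x) (hτ x) (hτ0 x)).2) ∈ denjoySpace shift := fun x =>
    isDenjoyMinimalSet_codingSet irrational_sqrt_two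
      (isCadlag_circleBlocks (hτ x) (hτ0 x) (n := n) fun k hk => by simp [τ, not_lt.2 hk])
      ⟨_, zero_mem_frontier_circleBlocks (hτ x)⟩ (countable_frontier_circleBlocks (hτ x))
      fun _ hc => (hc.eq_of_circleBlocks (hτ x) (hτ0 x) (hτ x) (hτ0 x)).2
  exact ⟨_, ⟨(hemb.codRestrict _ hmem).toHomeomorph.symm⟩⟩

end RotationCoding

theorem theorem0p1 :
    (∃ K : Set (WeakDisks.StrictlyErgodicSpace WeakDisks.shift),
      Nonempty (K ≃ₜ (ℕ → unitInterval))) ∧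
    (∀ n : ℕ, ∃ B : Set (WeakDisks.denjoySpace WeakDisks.shift),
      Nonempty (B ≃ₜ Metric.closedBall (0 : EuclideanSpace ℝ (Fin n)) 1)) :=
  ⟨RotationCoding.exists_hilbertCube, RotationCoding.exists_denjoyBall⟩
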